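/- Let $J_\nu$ and $Y_\nu$ denote the Bessel functions of the first and second kind of complex order $\nu$ (for integer $\nu$, $Y_\nu$ is the usual limit in the order). There is an absolute constant $C>0$ such that the following hold. 1. For all real $\sigma\ge 0$, $t\in\mathbb R$ and $x>0$, $$|J_{\sigma+it}(x)|\le C\,\bigl(1+|x^2-\sigma^2+t^2|+\sigma|t|\bigr)^{-1/4}e^{\frac{\pi}{2}|t|}.$$ 2. For all real $\sigma,t,x$ with $-1\le\sigma<x/2$ and $|t|<x$, and such that $x\ge 1$ or $\sigma\ge-\tfrac12$, $$|J_{\sigma+it}(x)|\le C\,x^{-1/2}e^{\frac{\pi}{2}|t|}.$$ 3. For all real $\sigma,t,x$ with $-1\le\sigma<x/2$ and $x\ge\max\{|t|,1\}$, $$|Y_{\sigma+it}(x)|\le C\,x^{-1/2}e^{\frac{\pi}{2}|t|}.$$ -/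

import Mathlib

open Filter Topology

/-- The Bessel function of the first kind `J_ν(x)` of complex order `ν` at a real point `x > 0`:
`J_ν(x) = (x/2)^ν ∑_k (-1)^k (x²/4)^k / (k! Γ(ν + k + 1))`.
Mathlib's `Complex.Gamma` is `0` at its poles, so `(Gamma _)⁻¹` is the entire function `1/Γ`. -/
noncomputable def besselJ (ν : ℂ) (x : ℝ) : ℂ :=
  ((x / 2 : ℝ) : ℂ) ^ ν *
    ∑' k : ℕ, ((-1) ^ k * ((x ^ 2 / 4 : ℝ) : ℂ) ^ k / (k.factorial : ℂ)) *
      (Complex.Gamma (ν + k + 1))⁻¹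

/-- `(J_ν(x) cos(πν) - J_{-ν}(x)) / sin(πν)`, which is `Y_ν(x)` when `ν` is not an integer. -/
noncomputable def besselYQuot (ν : ℂ) (x : ℝ) : ℂ :=
  (besselJ ν x * Complex.cos (Real.pi * ν) - besselJ (-ν) x) / Complex.sin (Real.pi * ν)

open scoped Classical in
/-- The Bessel function of the second kind `Y_ν(x)` of complex order `ν` at a real point `x > 0`:
`(J_ν(x) cos(πν) - J_{-ν}(x)) / sin(πν)`, and the limit of this quotient in `ν` at integer orders
(the limit exists, see `tendsto_besselYQuot`). -/
noncomputable def besselY (ν : ℂ) (x : ℝ) : ℂ :=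
  if ∃ n : ℤ, ν = n then limUnder (𝓝[≠] ν) (fun μ => besselYQuot μ x)
  else besselYQuot ν x

theorem exists_norm_inv_Gamma_le (R : ℝ) :
    ∃ M : ℝ, ∀ k : ℕ, ∀ ν ∈ Metric.closedBall (0 : ℂ) R,
      ‖(Complex.Gamma (ν + k + 1))⁻¹‖ ≤ M := by
  have h1 : ∀ k : ℕ, ∃ M : ℝ, ∀ ν ∈ Metric.closedBall (0 : ℂ) R,
      ‖(Complex.Gamma (ν + k + 1))⁻¹‖ ≤ M := by
    intro k
    refine (isCompact_closedBall (0 : ℂ) R).exists_bound_of_continuousOn ?_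
    have := Complex.differentiable_one_div_Gamma.continuous
    exact (this.comp (by fun_prop : Continuous fun ν : ℂ => ν + k + 1)).continuousOn
  choose M hM using h1
  obtain ⟨N, hN⟩ := exists_nat_ge R
  refine ⟨∑ k ∈ Finset.range (N + 1), |M k|, fun k ν hν => ?_⟩
  have hle : ∀ j ≤ N, ‖(Complex.Gamma (ν + j + 1))⁻¹‖ ≤ ∑ k ∈ Finset.range (N + 1), |M k| := by
    intro j hj
    refine ((hM j ν hν).trans (le_abs_self _)).trans ?_
    exact Finset.single_le_sum (f := fun k => |M k|) (fun _ _ => abs_nonneg _)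
      (Finset.mem_range.2 (by omega))
  rcases le_total k N with hk | hk
  · exact hle k hk
  · induction k, hk using Nat.le_induction with
    | base => exact hle N le_rfl
    | succ k hk ih =>
      have hν' : ‖ν‖ ≤ R := by simpa using hν
      have h2 : 1 ≤ ‖ν + k + 1‖ := by
        have h3 : ‖((k : ℂ) + 1)‖ = k + 1 := by
          have : ((k : ℂ) + 1) = ((k + 1 : ℕ) : ℂ) := by push_cast; ring
          rw [this, Complex.norm_natCast]; push_cast; ring
        have h4 := norm_sub_le (ν + k + 1) ν
        have h5 : ν + k + 1 - ν = (k : ℂ) + 1 := by ring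
        rw [h5, h3] at h4
        have : (N : ℝ) ≤ k := by exact_mod_cast hk
        linarith
      have h6 := Complex.one_div_Gamma_eq_self_mul_one_div_Gamma_add_one (ν + k + 1)
      rw [h6, norm_mul] at ih
      push_cast
      rw [show ν + ((k : ℂ) + 1) + 1 = ν + k + 1 + 1 by ring]
      nlinarith [norm_nonneg (Complex.Gamma (ν + k + 1 + 1))⁻¹]

theorem norm_besselJ_term_le {M : ℝ} (k : ℕ) (x : ℝ) {c : ℂ} (hc : ‖c‖ ≤ M) :
    ‖((-1) ^ k * ((x ^ 2 / 4 : ℝ) : ℂ) ^ k / (k.factorial : ℂ)) * c‖ ≤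
      (x ^ 2 / 4) ^ k / k.factorial * M := by
  rw [norm_mul, norm_div, norm_mul, norm_pow, norm_pow, norm_neg, norm_one, one_pow, one_mul,
    Complex.norm_real, Complex.norm_natCast, Real.norm_of_nonneg (by positivity)]
  gcongr

theorem summable_besselJ (ν : ℂ) (x : ℝ) :
    Summable fun k : ℕ => ((-1) ^ k * ((x ^ 2 / 4 : ℝ) : ℂ) ^ k / (k.factorial : ℂ)) *
      (Complex.Gamma (ν + k + 1))⁻¹ := by
  obtain ⟨M, hM⟩ := exists_norm_inv_Gamma_le ‖ν‖
  refine Summable.of_norm_bounded ((Real.summable_pow_div_factorial (x ^ 2 / 4)).mul_right M)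
    fun k => norm_besselJ_term_le k x (hM k ν (by simp))

theorem differentiable_besselJ {x : ℝ} (hx : 0 < x) :
    Differentiable ℂ fun ν : ℂ => besselJ ν x := by
  intro ν
  unfold besselJ
  refine DifferentiableAt.mul ?_ ?_
  · refine DifferentiableAt.const_cpow differentiableAt_id (Or.inl ?_)
    exact_mod_cast (by positivity : x / 2 ≠ 0)
  · obtain ⟨M, hM⟩ := exists_norm_inv_Gamma_le (‖ν‖ + 1)
    have h := Complex.differentiableOn_tsum_of_summable_norm
      (F := fun (k : ℕ) (ν : ℂ) => ((-1) ^ k * ((x ^ 2 / 4 : ℝ) : ℂ) ^ k / (k.factorial : ℂ)) *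
        (Complex.Gamma (ν + k + 1))⁻¹) (U := Metric.ball 0 (‖ν‖ + 1))
      ((Real.summable_pow_div_factorial (x ^ 2 / 4)).mul_right M) ?_ Metric.isOpen_ball ?_
    · exact h.differentiableAt (Metric.isOpen_ball.mem_nhds (by simp))
    · intro k
      have := Complex.differentiable_one_div_Gamma.comp
        (by fun_prop : Differentiable ℂ fun ν : ℂ => ν + k + 1)
      exact (this.const_mul _).differentiableOn
    · exact fun k w hw => norm_besselJ_term_le k x (hM k w (Metric.ball_subset_closedBall hw))

theorem besselJ_neg_nat (n : ℕ) {x : ℝ} (hx : 0 < x) :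
    besselJ (-(n : ℂ)) x = (-1) ^ n * besselJ n x := by
  have hz : ((x / 2 : ℝ) : ℂ) ≠ 0 := by exact_mod_cast (by positivity : x / 2 ≠ 0)
  unfold besselJ
  rw [← (summable_besselJ (-(n : ℂ)) x).sum_add_tsum_nat_add n, Finset.sum_eq_zero, zero_add,
    ← tsum_mul_left, ← tsum_mul_left, ← tsum_mul_left]
  · refine tsum_congr fun k => ?_
    have e1 : -(n : ℂ) + ((k + n : ℕ) : ℂ) + 1 = ((k : ℕ) : ℂ) + 1 := by push_cast; ring
    have e2 : (n : ℂ) + (k : ℂ) + 1 = ((n + k : ℕ) : ℂ) + 1 := by push_cast; ring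
    rw [e1, e2, Complex.Gamma_nat_eq_factorial, Complex.Gamma_nat_eq_factorial, Complex.cpow_neg,
      Complex.cpow_natCast, pow_add, pow_add, add_comm k n]
    have e3 : ((x ^ 2 / 4 : ℝ) : ℂ) = ((x / 2 : ℝ) : ℂ) ^ 2 := by push_cast; ring
    have f1 : ((k.factorial : ℕ) : ℂ) ≠ 0 := by exact_mod_cast k.factorial_ne_zero
    have f2 : (((n + k).factorial : ℕ) : ℂ) ≠ 0 := by exact_mod_cast (n + k).factorial_ne_zero
    rw [e3]
    field_simp
    ring
  · intro k hk
    have hk' := Finset.mem_range.1 hk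
    have : -(n : ℂ) + (k : ℂ) + 1 = -((n - 1 - k : ℕ) : ℂ) := by
      have : (n : ℂ) = ((n - 1 - k : ℕ) : ℂ) + k + 1 := by exact_mod_cast (by omega)
      rw [this]; push_cast; ring
    rw [this, Complex.Gamma_neg_nat_eq_zero, inv_zero, mul_zero]

theorem besselJ_neg_int (n : ℤ) {x : ℝ} (hx : 0 < x) :
    besselJ (-(n : ℂ)) x = Complex.cos (Real.pi * n) * besselJ n x := by
  have hc : ∀ m : ℕ, Complex.cos (Real.pi * m) = (-1) ^ m := by
    intro m
    have := Real.cos_nat_mul_pi m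
    have h2 := congrArg (fun r : ℝ => (r : ℂ)) this
    push_cast at h2
    rw [mul_comm, h2]
  obtain ⟨m, rfl | rfl⟩ := n.eq_nat_or_neg
  · push_cast
    rw [hc, besselJ_neg_nat m hx]
  · push_cast
    rw [neg_neg, mul_neg, Complex.cos_neg, hc, besselJ_neg_nat m hx, ← mul_assoc, ← mul_pow]
    simp

/-- At integer orders the limit that defines `besselY` exists. -/
theorem tendsto_besselYQuot (n : ℤ) {x : ℝ} (hx : 0 < x) :
    Tendsto (fun μ => besselYQuot μ x) (𝓝[≠] (n : ℂ)) (𝓝 (besselY n x)) := by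
  have hY : besselY n x = limUnder (𝓝[≠] (n : ℂ)) (fun μ => besselYQuot μ x) := by
    unfold besselY
    rw [if_pos ⟨n, rfl⟩]
  rw [hY]
  refine tendsto_nhds_limUnder ?_
  have hJ := differentiable_besselJ hx
  have hg : DifferentiableAt ℂ
      (fun ν : ℂ => besselJ ν x * Complex.cos (Real.pi * ν) - besselJ (-ν) x) n := by
    have h2 : Differentiable ℂ fun ν : ℂ => besselJ (-ν) x := hJ.comp differentiable_neg
    exact ((hJ _).mul (by fun_prop)).sub (h2 _)
  have hs : HasDerivAt (fun ν : ℂ => Complex.sin (Real.pi * ν))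
      (Complex.cos (Real.pi * n) * Real.pi) (n : ℂ) := by
    simpa using ((hasDerivAt_id (n : ℂ)).const_mul (Real.pi : ℂ)).csin
  have hs0 : Complex.sin (Real.pi * n) = 0 := by
    rw [mul_comm]; exact Complex.sin_int_mul_pi n
  have hne : Complex.cos (Real.pi * n) * Real.pi ≠ 0 := by
    refine mul_ne_zero (fun h => ?_) (by exact_mod_cast Real.pi_ne_zero)
    have := Complex.sin_sq_add_cos_sq (Real.pi * n)
    rw [hs0, h] at this
    norm_num at this
  refine ⟨_, ((hasDerivAt_iff_tendsto_slope.1 hg.hasDerivAt).div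
    (hasDerivAt_iff_tendsto_slope.1 hs) hne).congr' ?_⟩
  filter_upwards [self_mem_nhdsWithin] with μ hμ
  have hμ' : μ - n ≠ 0 := sub_ne_zero.2 hμ
  simp only [Pi.div_apply, slope_def_field, hs0, besselJ_neg_int n hx, besselYQuot]
  rw [div_div_div_cancel_right₀ hμ']
  congr 1 <;> ring

section

open MeasureTheory Set

/-! Put `ν = σ + it`. The quantity `N = 1 + |x² - σ² + t²| + σ|t|` is comparable to `1 + |x² - ν²|`,
so the first bound measures the distance to the turning point `ν = x`.

Summing Hankel's integral for `1/Γ` against the power series gives Schläfli's integral for `J_ν`.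
Its ray lies on `Im w = π`, where the factor `exp (-iπν)` would cost `exp (π|t|)`. For `Re ν > 0`
the ray is moved down to `Im w = π/2`. This produces `besselP`, and `J_ν` and `Y_ν` are half sum and
half difference of `besselP` at `ν` and its reflected conjugate (`besselJ_eq_besselP`,
`besselYQuot_eq_besselP`); `Y_ν` also contains a ray integral of size `O(1/x)` when `σ ≤ x/2 + 2`
and `x ≥ 1`.

Both pieces of `besselP` are oscillatory integrals with a monotone amplitude: phase `x sin θ - σθ`
and amplitude `exp (tθ)` on `[0, π/2]`, phase `x cosh u - tu` and amplitude `exp (-σu)` on the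
half-line. The first and second derivative tests bound them by a multiple of `M^(-1/2)`, with `M =
max σ |t| x ≥ 1` and `N ≤ 5M²`, up to the factor `exp (π|t|/2)` for the segment. The exception is
the segment when `σ` is comparable to `x` and `|t| ≤ 2x`: there the stationary point may approach `θ
= 0`, where the second derivative vanishes. That range is treated in
`norm_segment_pow_four_mul_le_turning`. The result is `norm_besselP_le`.

What remains is soft. For `M ≤ 1` the power series suffices. For `σ ≤ x/2 + 2` one has `N ≥ x²/64`,
which turns the first bound into `x^(-1/2)`. The three-term recurrence moves the bounds from `σ > 0`
to `σ ≥ -1`, and integer orders are reached as limits (`norm_le_of_recurrence`). -/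

/-! ### Oscillatory integrals: derivative tests and monotone amplitudes. -/

theorem intervalIntegral_abs_eq_of_sign {h : ℝ → ℝ} {a b : ℝ} (hab : a ≤ b)
    (hs : (∀ y ∈ Icc a b, 0 ≤ h y) ∨ (∀ y ∈ Icc a b, h y ≤ 0)) :
    ∫ y in a..b, |h y| = |∫ y in a..b, h y| := by
  rcases hs with hs | hs
  · rw [abs_of_nonneg (intervalIntegral.integral_nonneg hab hs)]
    refine intervalIntegral.integral_congr fun y hy => ?_
    rw [uIcc_of_le hab] at hy
    exact abs_of_nonneg (hs y hy)
  · have h1 : ∫ y in a..b, |h y| = -∫ y in a..b, h y := by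
      rw [← intervalIntegral.integral_neg]
      refine intervalIntegral.integral_congr fun y hy => ?_
      rw [uIcc_of_le hab] at hy
      exact abs_of_nonpos (hs y hy)
    have h2 : 0 ≤ ∫ y in a..b, |h y| :=
      intervalIntegral.integral_nonneg hab fun y _ => abs_nonneg _
    rw [h1, abs_of_nonpos (by linarith)]

/-- First derivative test for oscillatory integrals. -/
theorem norm_integral_cexp_le_of_deriv {φ φ' φ'' : ℝ → ℝ} (h1 : ∀ y, HasDerivAt φ (φ' y) y)
    (h2 : ∀ y, HasDerivAt φ' (φ'' y) y) (h3 : Continuous φ'') {a b l : ℝ} (hab : a ≤ b)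
    (hl : 0 < l) (hφ' : ∀ y ∈ Icc a b, l ≤ |φ' y|)
    (hs : (∀ y ∈ Icc a b, 0 ≤ φ'' y) ∨ (∀ y ∈ Icc a b, φ'' y ≤ 0)) :
    ‖∫ y in a..b, Complex.exp (φ y * Complex.I)‖ ≤ 4 / l := by
  have hc' : Continuous φ' := continuous_iff_continuousAt.2 fun y => (h2 y).continuousAt
  have hc : Continuous φ := continuous_iff_continuousAt.2 fun y => (h1 y).continuousAt
  have hne : ∀ y ∈ Icc a b, φ' y ≠ 0 := fun y hy h => by
    have := hφ' y hy
    rw [h, abs_zero] at this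
    linarith
  have hinv : ∀ y ∈ Icc a b, |(φ' y)⁻¹| ≤ l⁻¹ := fun y hy => by
    rw [abs_inv]
    exact inv_anti₀ hl (hφ' y hy)
  set q : ℝ → ℝ := fun y => φ'' y / φ' y ^ 2 with hq
  have hqc : ContinuousOn q (uIcc a b) := by
    rw [uIcc_of_le hab]
    exact h3.continuousOn.div (hc'.pow 2).continuousOn fun y hy => pow_ne_zero 2 (hne y hy)
  have hG : Continuous fun y => Complex.exp (φ y * Complex.I) := by fun_prop
  have hnG : ∀ y, ‖Complex.exp (φ y * Complex.I)‖ = 1 := fun y =>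
    Complex.norm_exp_ofReal_mul_I _
  have hd : ∀ y ∈ uIcc a b, HasDerivAt
      (fun y => ((φ' y)⁻¹ : ℝ) * Complex.exp (φ y * Complex.I))
      (((-q y : ℝ) : ℂ) * Complex.exp (φ y * Complex.I) +
        Complex.I * Complex.exp (φ y * Complex.I)) y := by
    intro y hy
    rw [uIcc_of_le hab] at hy
    have e1 := ((h2 y).fun_inv (hne y hy)).ofReal_comp
    have e2 := ((h1 y).ofReal_comp.mul_const Complex.I).cexp
    refine (e1.fun_mul e2).congr_deriv ?_
    have : (φ' y : ℂ) ≠ 0 := by exact_mod_cast hne y hy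
    simp only [hq]
    push_cast
    field_simp
  have i1 : IntervalIntegrable (fun y => ((-q y : ℝ) : ℂ) * Complex.exp (φ y * Complex.I))
      volume a b :=
    ((Complex.continuous_ofReal.comp_continuousOn hqc.neg).mul hG.continuousOn).intervalIntegrable
  have i2 : IntervalIntegrable (fun y => Complex.I * Complex.exp (φ y * Complex.I))
      volume a b := (continuous_const.mul hG).intervalIntegrable _ _
  have e := intervalIntegral.integral_eq_sub_of_hasDerivAt hd (i1.add i2)
  rw [intervalIntegral.integral_add i1 i2, intervalIntegral.integral_const_mul] at e
  have hdq : ∀ y ∈ uIcc a b, HasDerivAt (fun y => (φ' y)⁻¹) (-q y) y := by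
    intro y hy
    rw [uIcc_of_le hab] at hy
    simpa [hq, neg_div] using (h2 y).fun_inv (hne y hy)
  have eq := intervalIntegral.integral_eq_sub_of_hasDerivAt hdq hqc.neg.intervalIntegrable
  have hsq : (∀ y ∈ Icc a b, 0 ≤ -q y) ∨ (∀ y ∈ Icc a b, -q y ≤ 0) := by
    rcases hs with hs | hs
    · right
      intro y hy
      have := hs y hy
      have : 0 ≤ q y := by positivity
      linarith
    · left
      intro y hy
      have := div_nonpos_of_nonpos_of_nonneg (hs y hy) (sq_nonneg (φ' y))
      simp only [hq]
      linarith
  have n1 : ‖∫ y in a..b, ((-q y : ℝ) : ℂ) * Complex.exp (φ y * Complex.I)‖ ≤ 2 * l⁻¹ := by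
    refine (intervalIntegral.norm_integral_le_integral_norm hab).trans ?_
    simp_rw [norm_mul, hnG, mul_one, Complex.norm_real, Real.norm_eq_abs]
    -- The fixed sign of `φ''` makes `1/φ'` monotone, so its total variation is the difference of
    -- its end values.
    rw [intervalIntegral_abs_eq_of_sign hab hsq, eq]
    have := abs_sub (φ' b)⁻¹ (φ' a)⁻¹
    linarith [hinv a ⟨le_rfl, hab⟩, hinv b ⟨hab, le_rfl⟩]
  have n2 : ‖Complex.I * ∫ y in a..b, Complex.exp (φ y * Complex.I)‖ ≤ 4 * l⁻¹ := by
    rw [← eq_sub_iff_add_eq'] at e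
    rw [e]
    refine (norm_sub_le _ _).trans ?_
    have := norm_sub_le (((φ' b)⁻¹ : ℝ) * Complex.exp (φ b * Complex.I))
      (((φ' a)⁻¹ : ℝ) * Complex.exp (φ a * Complex.I))
    simp only [norm_mul, hnG, mul_one, Complex.norm_real, Real.norm_eq_abs] at this
    linarith [hinv a ⟨le_rfl, hab⟩, hinv b ⟨hab, le_rfl⟩]
  rwa [norm_mul, Complex.norm_I, one_mul, ← div_eq_mul_inv] at n2

theorem norm_integral_cexp_le_length (φ : ℝ → ℝ) {a b : ℝ} (hab : a ≤ b) :
    ‖∫ y in a..b, Complex.exp (φ y * Complex.I)‖ ≤ b - a := by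
  have := intervalIntegral.norm_integral_le_of_norm_le_const (a := a) (b := b) (C := 1)
    (f := fun y => Complex.exp (φ y * Complex.I))
    (fun y _ => (Complex.norm_exp_ofReal_mul_I _).le)
  rwa [one_mul, abs_of_nonneg (by linarith)] at this

/-- The window of radius `1/√l` around `c` is estimated by its length. Outside it `|φ'| ≥ √l`, and
the first derivative test applies on each side: `10 = 4 + 2 + 4`. -/
theorem norm_integral_cexp_le_of_abs_sub_le {φ φ' φ'' : ℝ → ℝ}
    (h1 : ∀ y, HasDerivAt φ (φ' y) y)
    (h2 : ∀ y, HasDerivAt φ' (φ'' y) y) (h3 : Continuous φ'') {a b c l : ℝ}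
    (hl : 0 < l) (hc : c ∈ Icc a b) (hφ' : ∀ y ∈ Icc a b, l * |y - c| ≤ |φ' y|)
    (hs : (∀ y ∈ Icc a b, 0 ≤ φ'' y) ∨ (∀ y ∈ Icc a b, φ'' y ≤ 0)) :
    ‖∫ y in a..b, Complex.exp (φ y * Complex.I)‖ ≤ 10 / √l := by
  have hcφ : Continuous φ := continuous_iff_continuousAt.2 fun y => (h1 y).continuousAt
  have hG : Continuous fun y => Complex.exp (φ y * Complex.I) := by fun_prop
  have hr : 0 < √l := Real.sqrt_pos.2 hl
  have hll : l * (√l)⁻¹ = √l := by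
    field_simp
    exact (Real.sq_sqrt hl.le).symm
  set h := (√l)⁻¹ with hh
  have hh0 : 0 < h := by positivity
  have key : ∀ p q, a ≤ p → p ≤ q → q ≤ b → (q ≤ c - h ∨ c + h ≤ p) →
      ‖∫ y in p..q, Complex.exp (φ y * Complex.I)‖ ≤ 4 / √l := by
    intro p q hap hpq hqb hpc
    refine norm_integral_cexp_le_of_deriv h1 h2 h3 hpq hr (fun y hy => ?_) ?_
    · refine le_trans ?_ (hφ' y ⟨hap.trans hy.1, hy.2.trans hqb⟩)
      rw [← hll]
      refine mul_le_mul_of_nonneg_left ?_ hl.le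
      rcases hpc with hpc | hpc
      · exact le_trans (by linarith [hy.2]) (neg_le_abs (y - c))
      · exact le_trans (by linarith [hy.1]) (le_abs_self (y - c))
    · exact hs.imp (fun H y hy => H y ⟨hap.trans hy.1, hy.2.trans hqb⟩)
        (fun H y hy => H y ⟨hap.trans hy.1, hy.2.trans hqb⟩)
  have h4 : (0 : ℝ) ≤ 4 / √l := by positivity
  have k1 : ‖∫ y in a..(max a (c - h)), Complex.exp (φ y * Complex.I)‖ ≤ 4 / √l := by
    rcases le_total a (c - h) with H | H
    · rw [max_eq_right H]
      exact key _ _ le_rfl H (by linarith [hc.2]) (Or.inl le_rfl)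
    · rw [max_eq_left H]
      simpa using h4
  have k2 : ‖∫ y in (min b (c + h))..b, Complex.exp (φ y * Complex.I)‖ ≤ 4 / √l := by
    rcases le_total b (c + h) with H | H
    · rw [min_eq_left H]
      simpa using h4
    · rw [min_eq_right H]
      exact key _ _ (by linarith [hc.1]) H le_rfl (Or.inr le_rfl)
  have k3 : ‖∫ y in (max a (c - h))..(min b (c + h)), Complex.exp (φ y * Complex.I)‖ ≤
      2 * h := by
    have hm : max a (c - h) ≤ c := max_le hc.1 (by linarith)
    have hm' : c ≤ min b (c + h) := le_min hc.2 (by linarith)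
    refine (norm_integral_cexp_le_length φ (hm.trans hm')).trans ?_
    linarith [le_max_right a (c - h), min_le_right b (c + h)]
  have hi : ∀ p q, IntervalIntegrable (fun y => Complex.exp (φ y * Complex.I)) volume p q :=
    fun p q => hG.intervalIntegrable _ _
  rw [← intervalIntegral.integral_add_adjacent_intervals (hi a (max a (c - h))) (hi _ b),
    ← intervalIntegral.integral_add_adjacent_intervals (hi _ (min b (c + h))) (hi _ b)]
  refine (norm_add_le _ _).trans ?_
  refine (add_le_add_right (norm_add_le _ _) _).trans ?_
  have : 10 / √l = 4 / √l + (2 * h + 4 / √l) := by rw [hh]; ring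
  linarith

/-- Take for `c` the zero of `f` if there is one, otherwise the endpoint where `|f|` is smallest,
and use the mean value inequality. -/
theorem exists_mul_abs_sub_le_abs {f f' : ℝ → ℝ} (h : ∀ y, HasDerivAt f (f' y) y) {a b l : ℝ}
    (hab : a ≤ b) (hf : ∀ y ∈ Icc a b, l ≤ f' y) :
    ∃ c ∈ Icc a b, ∀ y ∈ Icc a b, l * |y - c| ≤ |f y| := by
  have hc : Continuous f := continuous_iff_continuousAt.2 fun y => (h y).continuousAt
  have hmono : ∀ p ∈ Icc a b, ∀ q ∈ Icc a b, p ≤ q → l * (q - p) ≤ f q - f p := by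
    intro p hp q hq hpq
    refine (convex_Icc a b).mul_sub_le_image_sub_of_le_deriv hc.continuousOn
      (fun y _ => (h y).differentiableAt.differentiableWithinAt) (fun y hy => ?_) p hp q hq hpq
    rw [(h y).deriv]
    exact hf y (interior_subset hy)
  have ha : a ∈ Icc a b := ⟨le_rfl, hab⟩
  have hb : b ∈ Icc a b := ⟨hab, le_rfl⟩
  rcases le_total 0 (f a) with h0 | h0
  · refine ⟨a, ha, fun y hy => ?_⟩
    rw [abs_of_nonneg (by linarith [hy.1])]
    linarith [hmono a ha y hy hy.1, le_abs_self (f y)]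
  rcases le_total (f b) 0 with h0' | h0'
  · refine ⟨b, hb, fun y hy => ?_⟩
    rw [abs_of_nonpos (by linarith [hy.2])]
    linarith [hmono y hy b hb hy.2, neg_le_abs (f y)]
  obtain ⟨c, hcm, hc0⟩ := intermediate_value_Icc hab hc.continuousOn ⟨h0, h0'⟩
  refine ⟨c, hcm, fun y hy => ?_⟩
  rcases le_total c y with hcy | hcy
  · rw [abs_of_nonneg (by linarith)]
    linarith [hmono c hcm y hy hcy, le_abs_self (f y)]
  · rw [abs_of_nonpos (by linarith)]
    linarith [hmono y hy c hcm hcy, neg_le_abs (f y)]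

/-- Second derivative test for oscillatory integrals. -/
theorem norm_integral_cexp_le_of_deriv2 {φ φ' φ'' : ℝ → ℝ} (h1 : ∀ y, HasDerivAt φ (φ' y) y)
    (h2 : ∀ y, HasDerivAt φ' (φ'' y) y) (h3 : Continuous φ'') {a b l : ℝ} (hab : a ≤ b)
    (hl : 0 < l) (hs : (∀ y ∈ Icc a b, l ≤ φ'' y) ∨ (∀ y ∈ Icc a b, φ'' y ≤ -l)) :
    ‖∫ y in a..b, Complex.exp (φ y * Complex.I)‖ ≤ 10 / √l := by
  have : ∃ c ∈ Icc a b, ∀ y ∈ Icc a b, l * |y - c| ≤ |φ' y| := by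
    rcases hs with hs | hs
    · exact exists_mul_abs_sub_le_abs h2 hab hs
    · have := exists_mul_abs_sub_le_abs (f := fun y => -φ' y) (f' := fun y => -φ'' y)
        (fun y => (h2 y).neg) hab (fun y hy => by linarith [hs y hy])
      simpa only [abs_neg] using this
  obtain ⟨c, hc, hcy⟩ := this
  exact norm_integral_cexp_le_of_abs_sub_le h1 h2 h3 hl hc hcy
    (hs.imp (fun H y hy => by linarith [H y hy]) (fun H y hy => by linarith [H y hy]))

/-- Inserting a monotone amplitude into an integral whose primitive is bounded. -/
theorem norm_integral_mul_le_of_monotone {f : ℝ → ℂ} {g g' : ℝ → ℝ} (hf : Continuous f)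
    (hg : ∀ y, HasDerivAt g (g' y) y) (hg' : Continuous g') {a b A B : ℝ} (hab : a ≤ b)
    (hs : (∀ y ∈ Icc a b, 0 ≤ g' y) ∨ (∀ y ∈ Icc a b, g' y ≤ 0))
    (hA : ∀ y ∈ Icc a b, |g y| ≤ A) (hB : ∀ y ∈ Icc a b, ‖∫ s in a..y, f s‖ ≤ B) :
    ‖∫ y in a..b, f y * (g y : ℂ)‖ ≤ 3 * (A * B) := by
  have ha : a ∈ Icc a b := ⟨le_rfl, hab⟩
  have hb : b ∈ Icc a b := ⟨hab, le_rfl⟩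
  have hA0 : 0 ≤ A := (abs_nonneg _).trans (hA a ha)
  have hB0 : 0 ≤ B := (norm_nonneg _).trans (hB a ha)
  have hF : ∀ y, HasDerivAt (fun y => ∫ s in a..y, f s) (f y) y := fun y =>
    intervalIntegral.integral_hasDerivAt_right (hf.intervalIntegrable _ _)
      hf.stronglyMeasurable.stronglyMeasurableAtFilter hf.continuousAt
  -- Integration by parts against the primitive of `f`: the boundary term costs `AB` and the
  -- variation of `g` costs `2AB`. This is why the phase integrals below are bounded for every upper
  -- limit.
  have e := intervalIntegral.integral_deriv_mul_eq_sub_of_hasDerivAt (a := a) (b := b)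
    (u := fun y => ∫ s in a..y, f s)
    (v := fun y => (g y : ℂ)) (u' := f) (v' := fun y => (g' y : ℂ)) (fun y _ => (hF y).continuousAt.continuousWithinAt)
    (fun y _ => (hg y).ofReal_comp.continuousAt.continuousWithinAt) (fun y _ => hF y)
    (fun y _ => (hg y).ofReal_comp) (hf.intervalIntegrable _ _)
    ((Complex.continuous_ofReal.comp hg').intervalIntegrable _ _)
  have hFc : Continuous fun y => ∫ s in a..y, f s :=
    continuous_iff_continuousAt.2 fun y => (hF y).continuousAt
  have hgc : Continuous g := continuous_iff_continuousAt.2 fun y => (hg y).continuousAt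
  have j1 : Continuous fun y => f y * (g y : ℂ) := by fun_prop
  have j2 : Continuous fun y => (∫ s in a..y, f s) * (g' y : ℂ) := by fun_prop
  rw [intervalIntegral.integral_add (j1.intervalIntegrable _ _) (j2.intervalIntegrable _ _),
    ← eq_sub_iff_add_eq] at e
  rw [e, intervalIntegral.integral_same, zero_mul, sub_zero]
  refine (norm_sub_le _ _).trans ?_
  have n1 : ‖(∫ s in a..b, f s) * (g b : ℂ)‖ ≤ A * B := by
    rw [norm_mul, Complex.norm_real, mul_comm]
    exact mul_le_mul (hA b hb) (hB b hb) (norm_nonneg _) hA0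
  have n2 : ‖∫ y in a..b, (∫ s in a..y, f s) * (g' y : ℂ)‖ ≤ B * (2 * A) := by
    have : ‖∫ y in a..b, (∫ s in a..y, f s) * (g' y : ℂ)‖ ≤ ∫ y in a..b, B * |g' y| := by
      refine intervalIntegral.norm_integral_le_of_norm_le hab ?_
        ((continuous_const.mul hg'.abs).intervalIntegrable _ _)
      refine Eventually.of_forall fun y hy => ?_
      rw [norm_mul, Complex.norm_real]
      exact mul_le_mul_of_nonneg_right (hB y (Ioc_subset_Icc_self hy)) (norm_nonneg _)
    refine this.trans ?_
    rw [intervalIntegral.integral_const_mul, intervalIntegral_abs_eq_of_sign hab hs,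
      intervalIntegral.integral_eq_sub_of_hasDerivAt (fun y _ => hg y)
        (hg'.intervalIntegrable _ _)]
    refine mul_le_mul_of_nonneg_left ?_ hB0
    linarith [abs_sub (g b) (g a), hA a ha, hA b hb]
  linarith

/-! ### Hankel's contour integral for the reciprocal Gamma function. -/

theorem integrableOn_Ioi_of_norm_le_exp_neg {f : ℝ → ℂ} {K : ℝ} (hf : Continuous f)
    (h : ∀ u, 0 ≤ u → ‖f u‖ ≤ K * Real.exp (-u)) : IntegrableOn f (Ioi 0) := by
  have h1 : IntegrableOn (fun u : ℝ => K * Real.exp (-1 * u)) (Ioi 0) :=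
    (exp_neg_integrableOn_Ioi 0 one_pos).const_mul K
  refine h1.mono' hf.aestronglyMeasurable ?_
  filter_upwards [ae_restrict_mem measurableSet_Ioi] with u hu
  simpa using h u (le_of_lt hu)

/-- Complete the square after `exp u ≥ u²/2`. It gives an integrable majorant on the ray for every
`z`, without a condition on `Re z`. -/
theorem neg_mul_exp_sub_mul_le {a : ℝ} (ha : 0 < a) (s : ℝ) {u : ℝ} (hu : 0 ≤ u) :
    -(a * Real.exp u) - s * u ≤ (s - 1) ^ 2 / (2 * a) + -u := by
  have h1 := Real.quadratic_le_exp_of_nonneg hu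
  have h2 : a * (u ^ 2 / 2) ≤ a * Real.exp u :=
    mul_le_mul_of_nonneg_left (by linarith) ha.le
  have h3 : (s - 1) ^ 2 / (2 * a) + (s - 1) * u + a * (u ^ 2 / 2) =
      (s - 1 + a * u) ^ 2 / (2 * a) := by
    field_simp
    ring
  have h4 : 0 ≤ (s - 1 + a * u) ^ 2 / (2 * a) := by positivity
  nlinarith

theorem norm_cexp_neg_mul_exp_sub (a : ℝ) (z : ℂ) (u : ℝ) :
    ‖Complex.exp (-(a * Complex.exp u) - z * u)‖ =
      Real.exp (-(a * Real.exp u) - z.re * u) := by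
  rw [Complex.norm_exp]
  congr 1
  rw [Complex.sub_re, Complex.neg_re, ← Complex.ofReal_exp, Complex.re_ofReal_mul,
    Complex.ofReal_re, Complex.re_mul_ofReal]

/-- The part of Hankel's contour integral for `1 / Γ` over the vertical segment. -/
noncomputable def hankelSegment (a : ℝ) (z : ℂ) : ℂ :=
  ∫ θ in (-Real.pi)..Real.pi, Complex.exp (a * Complex.exp (θ * Complex.I) - z * (θ * Complex.I))

/-- The part of Hankel's contour integral for `1 / Γ` over the horizontal rays. -/
noncomputable def hankelRay (a : ℝ) (z : ℂ) : ℂ :=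
  ∫ u in Ioi (0 : ℝ), Complex.exp (-(a * Complex.exp u) - z * u)

theorem integrableOn_hankelRay {a : ℝ} (ha : 0 < a) (z : ℂ) :
    IntegrableOn (fun u : ℝ => Complex.exp (-(a * Complex.exp u) - z * u)) (Ioi 0) := by
  refine integrableOn_Ioi_of_norm_le_exp_neg (K := Real.exp ((z.re - 1) ^ 2 / (2 * a)))
    (by fun_prop) fun u hu => ?_
  rw [norm_cexp_neg_mul_exp_sub, ← Real.exp_add]
  exact Real.exp_le_exp.2 (neg_mul_exp_sub_mul_le ha _ hu)

/-- Integrate the derivative of the integrand. The term `exp (-a)` cancels against that of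
`hankelSegment_recurrence` when the two are combined in `hankel`. -/
theorem hankelRay_recurrence {a : ℝ} (ha : 0 < a) (z : ℂ) :
    z * hankelRay a z = Complex.exp (-a) - a * hankelRay a (z - 1) := by
  have hd : ∀ u : ℝ, HasDerivAt (fun u : ℝ => Complex.exp (-(a * Complex.exp u) - z * u))
      (-a * Complex.exp (-(a * Complex.exp u) - (z - 1) * u) +
        -z * Complex.exp (-(a * Complex.exp u) - z * u)) u := by
    intro u
    have h1 : HasDerivAt (fun u : ℝ => (u : ℂ)) 1 u := (hasDerivAt_id u).ofReal_comp
    refine (((h1.cexp.const_mul (a : ℂ)).fun_neg.fun_sub (h1.const_mul z)).cexp).congr_deriv ?_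
    rw [show -(a * Complex.exp u) - (z - 1) * u = (-(a * Complex.exp u) - z * u) + u by ring,
      Complex.exp_add _ (u : ℂ)]
    ring
  have i1 := (integrableOn_hankelRay ha (z - 1)).const_mul (-a : ℂ)
  have i2 := (integrableOn_hankelRay ha z).const_mul (-z)
  have ht : Tendsto (fun u : ℝ => Complex.exp (-(a * Complex.exp u) - z * u)) atTop (𝓝 0) := by
    rw [tendsto_zero_iff_norm_tendsto_zero]
    have h0 : Tendsto (fun u : ℝ => Real.exp ((z.re - 1) ^ 2 / (2 * a)) * Real.exp (-u)) atTop
        (𝓝 (Real.exp ((z.re - 1) ^ 2 / (2 * a)) * 0)) :=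
      (Real.tendsto_exp_neg_atTop_nhds_zero).const_mul _
    rw [mul_zero] at h0
    refine squeeze_zero' (Eventually.of_forall fun u => norm_nonneg _) ?_ h0
    filter_upwards [eventually_ge_atTop 0] with u hu
    rw [norm_cexp_neg_mul_exp_sub, ← Real.exp_add]
    exact Real.exp_le_exp.2 (neg_mul_exp_sub_mul_le ha _ hu)
  have e := integral_Ioi_of_hasDerivAt_of_tendsto (a := 0) (hd 0).continuousAt.continuousWithinAt
    (fun u _ => hd u) (i1.add i2) ht
  rw [integral_add i1 i2, integral_const_mul,
    integral_const_mul] at e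
  unfold hankelRay
  simp only [Complex.ofReal_zero, Complex.exp_zero, mul_one, mul_zero, sub_zero, zero_sub] at e
  linear_combination -e

theorem hankelSegment_recurrence (a : ℝ) (z : ℂ) :
    z * hankelSegment a z = a * hankelSegment a (z - 1) +
      2 * Complex.sin (Real.pi * z) * Complex.exp (-a) := by
  have hd : ∀ θ : ℝ, HasDerivAt (fun θ : ℝ =>
      Complex.exp (a * Complex.exp (θ * Complex.I) - z * (θ * Complex.I)))
      (Complex.I * a *
          Complex.exp (a * Complex.exp (θ * Complex.I) - (z - 1) * (θ * Complex.I)) -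
        Complex.I * z *
          Complex.exp (a * Complex.exp (θ * Complex.I) - z * (θ * Complex.I))) θ := by
    intro θ
    have h1 : HasDerivAt (fun u : ℝ => (u : ℂ) * Complex.I) (1 * Complex.I) θ :=
      (hasDerivAt_id θ).ofReal_comp.mul_const _
    refine (((h1.cexp.const_mul (a : ℂ)).fun_sub (h1.const_mul z)).cexp).congr_deriv ?_
    rw [show a * Complex.exp (θ * Complex.I) - (z - 1) * (θ * Complex.I) =
      (a * Complex.exp (θ * Complex.I) - z * (θ * Complex.I)) + θ * Complex.I by ring,
      Complex.exp_add _ (θ * Complex.I)]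
    ring
  have c : ∀ w : ℂ, Continuous fun θ : ℝ =>
      Complex.exp (a * Complex.exp (θ * Complex.I) - w * (θ * Complex.I)) := fun w => by
    fun_prop
  have i1 := ((c (z - 1)).const_mul (Complex.I * a)).intervalIntegrable (μ := volume)
    (-Real.pi) Real.pi
  have i2 := ((c z).const_mul (Complex.I * z)).intervalIntegrable (μ := volume)
    (-Real.pi) Real.pi
  have e := intervalIntegral.integral_eq_sub_of_hasDerivAt (fun θ _ => hd θ) (i1.sub i2)
  rw [intervalIntegral.integral_sub i1 i2, intervalIntegral.integral_const_mul,
    intervalIntegral.integral_const_mul] at e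
  have e1 : Complex.exp ((-Real.pi : ℝ) * Complex.I) = -1 := by
    push_cast
    rw [neg_mul, Complex.exp_neg, Complex.exp_pi_mul_I]
    norm_num
  rw [e1, Complex.exp_pi_mul_I] at e
  unfold hankelSegment
  rw [Complex.sin]
  rw [show (a : ℂ) * -1 - z * (Real.pi * Complex.I) = -(Real.pi * z) * Complex.I + -a by ring,
    show (a : ℂ) * -1 - z * ((-Real.pi : ℝ) * Complex.I) = (Real.pi * z) * Complex.I + -a by
      push_cast; ring, Complex.exp_add, Complex.exp_add] at e
  linear_combination Complex.I * e - (a * (∫ θ in (-Real.pi)..Real.pi,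
      Complex.exp (a * Complex.exp (θ * Complex.I) - (z - 1) * (θ * Complex.I))) -
     z * (∫ θ in (-Real.pi)..Real.pi,
      Complex.exp (a * Complex.exp (θ * Complex.I) - z * (θ * Complex.I)))) * Complex.I_sq

theorem integrableOn_Iic_hankel {a : ℝ} (ha : 0 < a) {z : ℂ} (hz : z.re < 0) :
    IntegrableOn (fun u : ℝ => Complex.exp (-(a * Complex.exp u) - z * u)) (Iic 0) := by
  have h1 : IntegrableOn (fun u : ℝ => Real.exp (-z.re * u)) (Iic 0) :=
    integrableOn_exp_mul_Iic (by linarith) 0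
  refine h1.mono' (by fun_prop) (Eventually.of_forall fun u => ?_)
  rw [norm_cexp_neg_mul_exp_sub]
  have : 0 < a * Real.exp u := by positivity
  exact Real.exp_le_exp.2 (by linarith)

/-- Cauchy's theorem for `exp (a exp w - z w)` on `[-R, 0] × [-π, π]`. On the horizontal sides `exp
w = -exp u`, and their factors `exp (∓iπz)` combine to the sine; the left side vanishes as `R → ∞`
because `Re z < 0`. -/
theorem hankelSegment_eq_of_re_neg {a : ℝ} (ha : 0 < a) {z : ℂ} (hz : z.re < 0) :
    hankelSegment a z = -2 * Complex.sin (Real.pi * z) *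
      ∫ u in Iic (0 : ℝ), Complex.exp (-(a * Complex.exp u) - z * u) := by
  set f : ℂ → ℂ := fun w => Complex.exp (a * Complex.exp w - z * w) with hf
  have hfd : Differentiable ℂ f := by fun_prop
  set g : ℝ → ℂ := fun u => Complex.exp (-(a * Complex.exp u) - z * u) with hg
  have e1 : Complex.exp (-(Real.pi * Complex.I)) = -1 := by
    rw [Complex.exp_neg, Complex.exp_pi_mul_I]
    norm_num
  have top : ∀ u : ℝ, f (u + Real.pi * Complex.I) =
      Complex.exp (-(Real.pi * z) * Complex.I) * g u := fun u => by
    simp only [hf, hg]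
    rw [Complex.exp_add u, Complex.exp_pi_mul_I, ← Complex.exp_add]
    congr 1
    ring
  have bot : ∀ u : ℝ, f (u + (-Real.pi : ℝ) * Complex.I) =
      Complex.exp ((Real.pi * z) * Complex.I) * g u := fun u => by
    simp only [hf, hg]
    push_cast
    rw [neg_mul, Complex.exp_add u, e1, ← Complex.exp_add]
    congr 1
    ring
  have rect : ∀ R : ℝ, (Complex.exp ((Real.pi * z) * Complex.I) -
      Complex.exp (-(Real.pi * z) * Complex.I)) * (∫ u in (-R)..0, g u) +
      Complex.I * hankelSegment a z =
      Complex.I * ∫ θ in (-Real.pi)..Real.pi, f ((-R : ℝ) + θ * Complex.I) := by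
    intro R
    have := Complex.integral_boundary_rect_eq_zero_of_differentiableOn f
      ⟨-R, -Real.pi⟩ ⟨0, Real.pi⟩ hfd.differentiableOn
    simp only [top, bot, intervalIntegral.integral_const_mul, smul_eq_mul] at this
    have hs : hankelSegment a z =
        ∫ y in (-Real.pi)..Real.pi, f ((0 : ℝ) + y * Complex.I) := by
      simp only [hankelSegment, hf, Complex.ofReal_zero, zero_add]
    rw [hs]
    linear_combination this
  have lim1 : Tendsto (fun R : ℝ => ∫ u in (-R)..0, g u) atTop (𝓝 (∫ u in Iic (0 : ℝ), g u)) :=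
    intervalIntegral_tendsto_integral_Iic 0 (integrableOn_Iic_hankel ha hz)
      tendsto_neg_atTop_atBot
  have lim2 : Tendsto (fun R : ℝ => ∫ θ in (-Real.pi)..Real.pi, f ((-R : ℝ) + θ * Complex.I))
      atTop (𝓝 0) := by
    rw [tendsto_zero_iff_norm_tendsto_zero]
    have h0 : Tendsto (fun R : ℝ => Real.exp (a + |z.im| * Real.pi) * Real.exp (z.re * R) *
        |Real.pi - -Real.pi|) atTop
        (𝓝 (Real.exp (a + |z.im| * Real.pi) * 0 * |Real.pi - -Real.pi|)) := by
      refine (Tendsto.const_mul _ ?_).mul_const _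
      exact Real.tendsto_exp_atBot.comp (tendsto_id.const_mul_atTop_of_neg hz)
    rw [mul_zero, zero_mul] at h0
    refine squeeze_zero' (Eventually.of_forall fun u => norm_nonneg _) ?_ h0
    filter_upwards [eventually_ge_atTop 0] with R hR
    refine intervalIntegral.norm_integral_le_of_norm_le_const fun θ hθ => ?_
    rw [uIoc_of_le (by linarith [Real.pi_pos])] at hθ
    simp only [hf]
    rw [Complex.norm_exp, ← Real.exp_add]
    refine Real.exp_le_exp.2 ?_
    have h3 : (a * Complex.exp (((-R : ℝ) : ℂ) + θ * Complex.I)).re ≤ a := by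
      rw [Complex.exp_add, ← Complex.ofReal_exp, Complex.re_ofReal_mul, Complex.re_ofReal_mul,
        Complex.exp_ofReal_mul_I_re]
      have : Real.exp (-R) * Real.cos θ ≤ 1 := by
        have h5 : Real.exp (-R) ≤ 1 := Real.exp_le_one_iff.2 (by linarith)
        nlinarith [Real.cos_le_one θ, Real.exp_pos (-R)]
      nlinarith
    have h4 : (z * (((-R : ℝ) : ℂ) + θ * Complex.I)).re = -(z.re * R) - z.im * θ := by
      simp
    rw [Complex.sub_re, h4]
    have h5 : z.im * θ ≤ |z.im| * Real.pi := by
      refine (le_abs_self _).trans ?_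
      rw [abs_mul]
      exact mul_le_mul_of_nonneg_left (abs_le.2 ⟨hθ.1.le, hθ.2⟩) (abs_nonneg _)
    linarith
  have e := tendsto_nhds_unique (((lim1.const_mul _).add_const _).congr rect)
    (lim2.const_mul Complex.I)
  rw [Complex.sin]
  linear_combination -Complex.I * e + hankelSegment a z * Complex.I_sq

/-- Euler's integral for `Γ(-z)` after the substitution `s = exp u`. -/
theorem integral_cexp_neg_mul_exp_sub {a : ℝ} (ha : 0 < a) {z : ℂ} (hz : z.re < 0) :
    ∫ u : ℝ, Complex.exp (-(a * Complex.exp u) - z * u) = (a : ℂ) ^ z * Complex.Gamma (-z) := by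
  have h := Complex.integral_cpow_mul_exp_neg_mul_Ioi (a := -z) (r := a) (by simpa using hz) ha
  have him : Real.exp '' univ = Ioi 0 := by rw [image_univ, Real.range_exp]
  rw [← him, integral_image_eq_integral_abs_deriv_smul MeasurableSet.univ
    (fun u _ => (Real.hasDerivAt_exp u).hasDerivWithinAt) Real.exp_injective.injOn,
    Measure.restrict_univ] at h
  have e1 : ((1 : ℂ) / a) ^ (-z) = (a : ℂ) ^ z := by
    rw [one_div, Complex.inv_cpow _ _ (by
      rw [Complex.arg_ofReal_of_nonneg ha.le]; exact Real.pi_pos.ne), Complex.cpow_neg, inv_inv]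
  rw [e1] at h
  rw [← h]
  refine integral_congr_ae (Eventually.of_forall fun u => ?_)
  have hne : (Real.exp u : ℂ) ≠ 0 := by exact_mod_cast (Real.exp_pos u).ne'
  simp only [abs_of_pos (Real.exp_pos u), Complex.real_smul]
  rw [Complex.cpow_def_of_ne_zero hne, ← Complex.ofReal_log (Real.exp_pos u).le, Real.log_exp,
    Complex.ofReal_exp, ← Complex.exp_add, ← Complex.exp_add]
  congr 1
  ring

/-- Hankel's contour integral for `1 / Γ`. -/
theorem hankel_of_re_neg {a : ℝ} (ha : 0 < a) {z : ℂ} (hz : z.re < 0)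
    (hs : Complex.sin (Real.pi * z) ≠ 0) :
    hankelSegment a z / (2 * Real.pi) - Complex.sin (Real.pi * z) / Real.pi * hankelRay a z =
      (a : ℂ) ^ z * (Complex.Gamma (z + 1))⁻¹ := by
  have hpi : (Real.pi : ℂ) ≠ 0 := by exact_mod_cast Real.pi_ne_zero
  have e1 := intervalIntegral.integral_Iic_add_Ioi (integrableOn_Iic_hankel ha hz)
    (integrableOn_hankelRay ha z)
  rw [integral_cexp_neg_mul_exp_sub ha hz] at e1
  -- The half-lines join to the full line, which gives `Γ(-z)`; the reflection formula turns it into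
  -- `1/Γ(z + 1)`.
  have e2 := Complex.Gamma_mul_Gamma_one_sub (-z)
  rw [sub_neg_eq_add, add_comm 1 z, mul_neg, Complex.sin_neg] at e2
  have e3 : (Complex.Gamma (z + 1))⁻¹ =
      -(Complex.sin (Real.pi * z) / Real.pi) * Complex.Gamma (-z) := by
    refine (eq_inv_of_mul_eq_one_left ?_).symm
    rw [mul_assoc, e2]
    field_simp
  rw [hankelSegment_eq_of_re_neg ha hz, e3]
  unfold hankelRay
  have h4 : ∀ p q r s : ℂ, p + q = r →
      -2 * s * p / (2 * Real.pi) - s / Real.pi * q = -(s / Real.pi) * r := by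
    intro p q r s h
    rw [← h]
    field_simp
    ring
  rw [h4 _ _ _ _ e1]
  ring

/-- Both sides satisfy the same first-order recurrence in `z`, so the identity spreads from `Re z <
0` to the right in unit steps. -/
theorem hankel {a : ℝ} (ha : 0 < a) {z : ℂ} (hs : Complex.sin (Real.pi * z) ≠ 0) :
    hankelSegment a z / (2 * Real.pi) - Complex.sin (Real.pi * z) / Real.pi * hankelRay a z =
      (a : ℂ) ^ z * (Complex.Gamma (z + 1))⁻¹ := by
  obtain ⟨n, hn⟩ := exists_nat_gt z.re
  induction n generalizing z with
  | zero => exact hankel_of_re_neg ha (by simpa using hn) hs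
  | succ n ih =>
    have hpi : (Real.pi : ℂ) ≠ 0 := by exact_mod_cast Real.pi_ne_zero
    have hz : z ≠ 0 := fun h => hs (by simp [h])
    have ha' : (a : ℂ) ≠ 0 := by exact_mod_cast ha.ne'
    have hsin : Complex.sin (Real.pi * (z - 1)) = -Complex.sin (Real.pi * z) := by
      rw [mul_sub, mul_one, Complex.sin_sub_pi]
    have h1 := ih (z := z - 1) (by rw [hsin]; exact neg_ne_zero.2 hs)
      (by simp at hn ⊢; linarith)
    rw [hsin, sub_add_cancel, Complex.cpow_sub _ _ ha', Complex.cpow_one,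
      Complex.one_div_Gamma_eq_self_mul_one_div_Gamma_add_one] at h1
    have h2 := hankelRay_recurrence ha z
    have h3 := hankelSegment_recurrence a z
    refine mul_left_cancel₀ hz ?_
    have h5 : z * (hankelSegment a z / (2 * Real.pi) -
        Complex.sin (Real.pi * z) / Real.pi * hankelRay a z) =
        a * (hankelSegment a (z - 1) / (2 * Real.pi) -
          -Complex.sin (Real.pi * z) / Real.pi * hankelRay a (z - 1)) := by
      have : z * (hankelSegment a z / (2 * Real.pi) -
        Complex.sin (Real.pi * z) / Real.pi * hankelRay a z) =
        z * hankelSegment a z / (2 * Real.pi) -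
        Complex.sin (Real.pi * z) / Real.pi * (z * hankelRay a z) := by ring
      rw [this, h2, h3]
      field_simp
      ring
    rw [h5, h1]
    field_simp

/-! ### Schläfli's integral for `J_ν`. -/

/-- It sums the Hankel integrands at `z = ν + k` to a single exponential. -/
theorem hasSum_cpow_div_factorial_mul_cexp (c w d : ℂ) :
    HasSum (fun k : ℕ => c ^ k / (k.factorial : ℂ) * Complex.exp (w + k * d))
      (Complex.exp (w + c * Complex.exp d)) := by
  have h := (NormedSpace.expSeries_div_hasSum_exp (c * Complex.exp d)).mul_left (Complex.exp w)
  rw [← Complex.exp_eq_exp_ℂ, ← Complex.exp_add] at h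
  refine h.congr_fun fun k => ?_
  rw [Complex.exp_add, Complex.exp_nat_mul, mul_pow]
  ring

theorem hasSum_hankelSegment {a : ℝ} (ha : 0 < a) (ν : ℂ) :
    HasSum (fun k : ℕ => (-a : ℂ) ^ k / (k.factorial : ℂ) * hankelSegment a (ν + k))
      (∫ θ in (-Real.pi)..Real.pi,
        Complex.exp (((2 * a : ℝ) * Complex.sin θ - ν * θ) * Complex.I)) := by
  have h := intervalIntegral.hasSum_integral_of_dominated_convergence (ι := ℕ) (μ := volume)
    (a := -Real.pi) (b := Real.pi)
    (F := fun k θ => (-a : ℂ) ^ k / (k.factorial : ℂ) *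
      Complex.exp (a * Complex.exp (θ * Complex.I) - (ν + k) * (θ * Complex.I)))
    (f := fun θ => Complex.exp (((2 * a : ℝ) * Complex.sin θ - ν * θ) * Complex.I))
    (fun k _ => a ^ k / k.factorial * Real.exp (a + |ν.im| * Real.pi)) ?_ ?_ ?_ ?_ ?_
  · simpa only [hankelSegment, intervalIntegral.integral_const_mul] using h
  · intro k
    refine Continuous.aestronglyMeasurable ?_
    fun_prop
  · refine fun k => Eventually.of_forall fun θ hθ => ?_
    rw [uIoc_of_le (by linarith [Real.pi_pos])] at hθ
    rw [norm_mul, norm_div, norm_pow, norm_neg, Complex.norm_real, Complex.norm_natCast,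
      Real.norm_of_nonneg ha.le, Complex.norm_exp]
    refine mul_le_mul_of_nonneg_left (Real.exp_le_exp.2 ?_) (by positivity)
    have h4 : ((ν + k) * (θ * Complex.I)).re = - ν.im * θ := by simp
    rw [Complex.sub_re, h4, Complex.re_ofReal_mul, Complex.exp_ofReal_mul_I_re]
    have h5 : ν.im * θ ≤ |ν.im| * Real.pi := by
      refine (le_abs_self _).trans ?_
      rw [abs_mul]
      exact mul_le_mul_of_nonneg_left (abs_le.2 ⟨hθ.1.le, hθ.2⟩) (abs_nonneg _)
    nlinarith [Real.cos_le_one θ]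
  · exact Eventually.of_forall fun θ _ => (Real.summable_pow_div_factorial a).mul_right _
  · exact intervalIntegrable_const
  · refine Eventually.of_forall fun θ _ => ?_
    have := hasSum_cpow_div_factorial_mul_cexp (-a)
      (a * Complex.exp (θ * Complex.I) - ν * (θ * Complex.I)) (-(θ * Complex.I))
    have e : ((2 * a : ℝ) * Complex.sin θ - ν * θ) * Complex.I = a * Complex.exp (θ * Complex.I) -
        ν * (θ * Complex.I) + -a * Complex.exp (-(θ * Complex.I)) := by
      rw [Complex.sin, neg_mul]
      push_cast
      linear_combination (a * (Complex.exp (-(θ * Complex.I)) - Complex.exp (θ * Complex.I))) *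
        Complex.I_sq
    rw [e]
    refine this.congr_fun fun k => ?_
    congr 2
    ring

/-- The integral over the ray in Schläfli's integral for Bessel functions. -/
noncomputable def schlafliRay (ν : ℂ) (x : ℝ) : ℂ :=
  ∫ u in Ioi (0 : ℝ), Complex.exp (-(x * Complex.sinh u) - ν * u)

/-- The integral over the segment in Schläfli's integral for Hankel functions. -/
noncomputable def schlafliSegment (ν : ℂ) (x : ℝ) : ℂ :=
  ∫ θ in (0 : ℝ)..Real.pi, Complex.exp ((x * Complex.sin θ - ν * θ) * Complex.I)

theorem hasSum_hankelRay {a : ℝ} (ha : 0 < a) (ν : ℂ) :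
    HasSum (fun k : ℕ => (a : ℂ) ^ k / (k.factorial : ℂ) * hankelRay a (ν + k))
      (schlafliRay ν (2 * a)) := by
  have h := hasSum_integral_of_dominated_convergence (ι := ℕ) (μ := volume.restrict (Ioi 0))
    (F := fun k (u : ℝ) => (a : ℂ) ^ k / (k.factorial : ℂ) *
      Complex.exp (-(a * Complex.exp u) - (ν + k) * u))
    (f := fun u : ℝ => Complex.exp (-((2 * a : ℝ) * Complex.sinh u) - ν * u))
    (fun k u => a ^ k / k.factorial * Real.exp (-(a * Real.exp u) - ν.re * u)) ?_ ?_ ?_ ?_ ?_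
  · simpa only [hankelRay, schlafliRay, integral_const_mul] using h
  · intro k
    refine Continuous.aestronglyMeasurable ?_
    fun_prop
  · intro k
    filter_upwards [ae_restrict_mem measurableSet_Ioi] with u hu
    rw [norm_mul, norm_div, norm_pow, Complex.norm_real, Complex.norm_natCast,
      Real.norm_of_nonneg ha.le, norm_cexp_neg_mul_exp_sub]
    refine mul_le_mul_of_nonneg_left (Real.exp_le_exp.2 ?_) (by positivity)
    have h1 : (0 : ℝ) < u := hu
    have : 0 ≤ (k : ℝ) * u := by positivity
    simp only [Complex.add_re, Complex.natCast_re]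
    linarith
  · exact Eventually.of_forall fun θ => (Real.summable_pow_div_factorial a).mul_right _
  · simp_rw [tsum_mul_right]
    refine Integrable.const_mul ?_ _
    have := (integrableOn_hankelRay ha ν).norm
    simpa only [norm_cexp_neg_mul_exp_sub] using this
  · refine Eventually.of_forall fun u => ?_
    have := hasSum_cpow_div_factorial_mul_cexp a (-(a * Complex.exp u) - ν * u) (-u)
    have e : -((2 * a : ℝ) * Complex.sinh u) - ν * u =
        -(a * Complex.exp u) - ν * u + a * Complex.exp (-u) := by
      rw [Complex.sinh]
      push_cast
      ring
    rw [e]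
    refine this.congr_fun fun k => ?_
    congr 2
    ring

theorem sin_pi_mul_add_nat (ν : ℂ) (k : ℕ) :
    Complex.sin (Real.pi * (ν + k)) = (-1) ^ k * Complex.sin (Real.pi * ν) := by
  rw [mul_add, mul_comm (Real.pi : ℂ) k, Complex.sin_antiperiodic.add_nat_mul_eq]

/-- Schläfli's integral for `J_ν`. -/
theorem besselJ_eq_schlafli {ν : ℂ} {x : ℝ} (hx : 0 < x) (hs : Complex.sin (Real.pi * ν) ≠ 0) :
    besselJ ν x = (∫ θ in (-Real.pi)..Real.pi,
        Complex.exp ((x * Complex.sin θ - ν * θ) * Complex.I)) / (2 * Real.pi) -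
      Complex.sin (Real.pi * ν) / Real.pi * schlafliRay ν x := by
  obtain ⟨a, rfl⟩ : ∃ a, x = 2 * a := ⟨x / 2, by ring⟩
  have ha : 0 < a := by linarith
  have ha' : (a : ℂ) ≠ 0 := by exact_mod_cast ha.ne'
  have h := ((hasSum_hankelSegment ha ν).div_const (2 * (Real.pi : ℂ))).sub
    ((hasSum_hankelRay ha ν).mul_left (Complex.sin (Real.pi * ν) / Real.pi))
  rw [← h.tsum_eq, besselJ, ← tsum_mul_left]
  refine tsum_congr fun k => ?_
  have hk : Complex.sin (Real.pi * (ν + k)) ≠ 0 := by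
    rw [sin_pi_mul_add_nat]
    exact mul_ne_zero (pow_ne_zero _ (by norm_num)) hs
  -- With `a = x/2`, the `k`-th term of the series is Hankel's formula at `z = ν + k`. The sign of
  -- `sin (π(ν + k))` cancels `(-1)^k` in the ray, so the segment is summed with `-a` and the ray
  -- with `+a`.
  have e := hankel ha hk
  rw [sin_pi_mul_add_nat, Complex.cpow_add _ _ ha', Complex.cpow_natCast] at e
  have e2 : (((2 * a) / 2 : ℝ) : ℂ) = a := by push_cast; ring
  have e3 : (((2 * a) ^ 2 / 4 : ℝ) : ℂ) = (a : ℂ) * a := by push_cast; ring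
  have e4 : ((-1 : ℂ) ^ k) * (-1) ^ k = 1 := by rw [← mul_pow]; simp
  rw [e2, e3, neg_pow (a : ℂ) k, mul_pow]
  linear_combination (-((-1) ^ k * (a : ℂ) ^ k / (k.factorial : ℂ))) * e -
    (a : ℂ) ^ k / (k.factorial : ℂ) * Complex.sin (Real.pi * ν) / Real.pi *
      hankelRay a (ν + k) * e4

/-! ### Symmetries of the Schläfli integrals and the shift to the contour of `besselP`. -/

theorem conj_schlafliSegment (ν : ℂ) (x : ℝ) :
    (starRingEnd ℂ) (schlafliSegment ((starRingEnd ℂ) ν) x) =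
      ∫ θ in (0 : ℝ)..Real.pi, Complex.exp (-((x * Complex.sin θ - ν * θ) * Complex.I)) := by
  unfold schlafliSegment
  rw [intervalIntegral.integral_of_le Real.pi_pos.le, ← integral_conj,
    intervalIntegral.integral_of_le Real.pi_pos.le]
  congr 1
  funext θ
  rw [← Complex.exp_conj]
  congr 1
  simp [← Complex.sin_conj]

theorem integral_neg_pi_pi_schlafli (ν : ℂ) (x : ℝ) :
    ∫ θ in (-Real.pi)..Real.pi, Complex.exp ((x * Complex.sin θ - ν * θ) * Complex.I) =
      schlafliSegment ν x + (starRingEnd ℂ) (schlafliSegment ((starRingEnd ℂ) ν) x) := by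
  have c : Continuous fun θ : ℝ =>
    Complex.exp ((x * Complex.sin θ - ν * θ) * Complex.I) := by fun_prop
  rw [conj_schlafliSegment, ← intervalIntegral.integral_add_adjacent_intervals
    (c.intervalIntegrable (-Real.pi) 0) (c.intervalIntegrable 0 Real.pi), add_comm]
  congr 1
  have := intervalIntegral.integral_comp_neg (a := 0) (b := Real.pi)
    (fun θ : ℝ => Complex.exp ((x * Complex.sin θ - ν * θ) * Complex.I))
  rw [neg_zero] at this
  rw [← this]
  refine intervalIntegral.integral_congr fun θ _ => ?_
  simp only [Complex.ofReal_neg, Complex.sin_neg]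
  congr 1
  ring

/-- Substitute `θ ↦ π - θ`. -/
theorem schlafliSegment_neg (ν : ℂ) (x : ℝ) :
    schlafliSegment (-ν) x = Complex.exp (Real.pi * ν * Complex.I) * schlafliSegment ν x := by
  have := intervalIntegral.integral_comp_sub_left (a := 0) (b := Real.pi)
    (fun θ : ℝ => Complex.exp ((x * Complex.sin θ - -ν * θ) * Complex.I)) Real.pi
  rw [sub_self, sub_zero] at this
  unfold schlafliSegment
  rw [← this, ← intervalIntegral.integral_const_mul]
  refine intervalIntegral.integral_congr fun θ _ => ?_
  simp only [Complex.ofReal_sub, Complex.sin_pi_sub]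
  rw [← Complex.exp_add]
  congr 1
  ring

theorem integrableOn_schlafliRay (ν : ℂ) {x : ℝ} (hx : 0 < x) :
    IntegrableOn (fun u : ℝ => Complex.exp (-(x * Complex.sinh u) - ν * u)) (Ioi 0) := by
  have hx2 : 0 < x / 2 := by positivity
  refine integrableOn_Ioi_of_norm_le_exp_neg
    (K := Real.exp (x / 2 + (ν.re - 1) ^ 2 / (2 * (x / 2)))) (by fun_prop) fun u hu => ?_
  rw [Complex.norm_exp, ← Real.exp_add]
  refine Real.exp_le_exp.2 ?_
  have h1 := neg_mul_exp_sub_mul_le hx2 ν.re hu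
  rw [← Complex.ofReal_sinh, Complex.sub_re, Complex.neg_re, Complex.re_ofReal_mul,
    Complex.ofReal_re, Complex.re_mul_ofReal, Real.sinh_eq]
  have h2 : Real.exp (-u) ≤ 1 := Real.exp_le_one_iff.2 (by linarith)
  nlinarith

/-- The Hankel function `π H⁽¹⁾_ν(x)`, up to a term that cancels in `J_ν`, as an integral over a
contour on which the exponential has modulus at most `exp (π |Im ν| / 2)`. -/
noncomputable def besselP (ν : ℂ) (x : ℝ) : ℂ :=
  (∫ θ in (0 : ℝ)..(Real.pi / 2), Complex.exp ((x * Complex.sin θ - ν * θ) * Complex.I)) -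
    Complex.I * Complex.exp (-(Real.pi / 2 * ν) * Complex.I) *
      ∫ u in Ioi (0 : ℝ), Complex.exp (x * Complex.cosh u * Complex.I - ν * u)

theorem integrableOn_besselP {ν : ℂ} (hν : 0 < ν.re) (x : ℝ) :
    IntegrableOn (fun u : ℝ => Complex.exp (x * Complex.cosh u * Complex.I - ν * u))
      (Ioi 0) := by
  have h1 : IntegrableOn (fun u : ℝ => Real.exp (-ν.re * u)) (Ioi 0) :=
    exp_neg_integrableOn_Ioi 0 hν
  refine h1.mono' (by fun_prop) (Eventually.of_forall fun u => ?_)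
  rw [Complex.norm_exp, ← Complex.ofReal_cosh, ← Complex.ofReal_mul]
  simp

/-- Cauchy's theorem for `exp (x sinh w - ν w)` on `[0, R] × [π/2, π]`. There `Re (sinh w) = sinh u
cos θ ≤ 0`, so `Re ν > 0` makes the right side vanish as `R → ∞`. -/
theorem schlafliSegment_sub_schlafliRay {ν : ℂ} (hν : 0 < ν.re) {x : ℝ} (hx : 0 < x) :
    schlafliSegment ν x - Complex.I * Complex.exp (-(Real.pi * ν) * Complex.I) *
      schlafliRay ν x = besselP ν x := by
  set f : ℂ → ℂ := fun w => Complex.exp (x * Complex.sinh w - ν * w) with hf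
  have hfd : Differentiable ℂ f := by fun_prop
  have top : ∀ u : ℝ, f (u + Real.pi * Complex.I) =
      Complex.exp (-(Real.pi * ν) * Complex.I) *
        Complex.exp (-(x * Complex.sinh u) - ν * u) := fun u => by
    simp only [hf]
    rw [Complex.sinh_add, Complex.cosh_mul_I, Complex.sinh_mul_I, Complex.cos_pi,
      Complex.sin_pi, ← Complex.exp_add]
    congr 1
    ring
  have bot : ∀ u : ℝ, f (u + (Real.pi / 2 : ℝ) * Complex.I) =
      Complex.exp (-(Real.pi / 2 * ν) * Complex.I) *
        Complex.exp (x * Complex.cosh u * Complex.I - ν * u) := fun u => by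
    simp only [hf]
    push_cast
    rw [Complex.sinh_add, Complex.cosh_mul_I, Complex.sinh_mul_I, Complex.cos_pi_div_two,
      Complex.sin_pi_div_two, ← Complex.exp_add]
    congr 1
    ring
  have left : ∀ θ : ℝ, f ((0 : ℝ) + θ * Complex.I) =
      Complex.exp ((x * Complex.sin θ - ν * θ) * Complex.I) := fun θ => by
    simp only [hf]
    rw [Complex.ofReal_zero, zero_add, Complex.sinh_mul_I]
    congr 1
    ring
  have rect : ∀ R : ℝ, Complex.exp (-(Real.pi / 2 * ν) * Complex.I) *
        (∫ u in (0 : ℝ)..R, Complex.exp (x * Complex.cosh u * Complex.I - ν * u)) -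
      Complex.exp (-(Real.pi * ν) * Complex.I) *
        (∫ u in (0 : ℝ)..R, Complex.exp (-(x * Complex.sinh u) - ν * u)) -
      Complex.I * (∫ θ in (Real.pi / 2)..Real.pi,
        Complex.exp ((x * Complex.sin θ - ν * θ) * Complex.I)) =
      -Complex.I * ∫ θ in (Real.pi / 2)..Real.pi, f (R + θ * Complex.I) := by
    intro R
    have := Complex.integral_boundary_rect_eq_zero_of_differentiableOn f
      ⟨0, Real.pi / 2⟩ ⟨R, Real.pi⟩ hfd.differentiableOn
    simp only [top, bot, left, intervalIntegral.integral_const_mul, smul_eq_mul] at this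
    linear_combination this
  have lim1 := intervalIntegral_tendsto_integral_Ioi 0 (integrableOn_besselP hν x) tendsto_id
  have lim2 := intervalIntegral_tendsto_integral_Ioi 0 (integrableOn_schlafliRay ν hx) tendsto_id
  have lim3 : Tendsto (fun R : ℝ => ∫ θ in (Real.pi / 2)..Real.pi, f (R + θ * Complex.I))
      atTop (𝓝 0) := by
    rw [tendsto_zero_iff_norm_tendsto_zero]
    have h0 : Tendsto (fun R : ℝ => Real.exp (|ν.im| * Real.pi) * Real.exp (-ν.re * R) *
        |Real.pi - Real.pi / 2|) atTop
        (𝓝 (Real.exp (|ν.im| * Real.pi) * 0 * |Real.pi - Real.pi / 2|)) := by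
      refine (Tendsto.const_mul _ ?_).mul_const _
      exact Real.tendsto_exp_atBot.comp
        (tendsto_id.const_mul_atTop_of_neg (neg_neg_of_pos hν))
    rw [mul_zero, zero_mul] at h0
    refine squeeze_zero' (Eventually.of_forall fun u => norm_nonneg _) ?_ h0
    filter_upwards [eventually_ge_atTop 0] with R hR
    refine intervalIntegral.norm_integral_le_of_norm_le_const fun θ hθ => ?_
    rw [uIoc_of_le (by linarith [Real.pi_pos])] at hθ
    simp only [hf]
    rw [Complex.norm_exp, ← Real.exp_add]
    refine Real.exp_le_exp.2 ?_
    have h3 : (x * Complex.sinh (R + θ * Complex.I)).re = x * (Real.sinh R * Real.cos θ) := by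
      rw [Complex.sinh_add, Complex.cosh_mul_I, Complex.sinh_mul_I, ← Complex.ofReal_sinh,
        ← Complex.ofReal_cosh, ← Complex.ofReal_cos, ← Complex.ofReal_sin]
      have : (x : ℂ) * (Real.sinh R * Real.cos θ + Real.cosh R * (Real.sin θ * Complex.I)) =
          ((x * (Real.sinh R * Real.cos θ) : ℝ) : ℂ) +
            ((x * (Real.cosh R * Real.sin θ) : ℝ) : ℂ) * Complex.I := by
        push_cast
        ring
      rw [this, Complex.add_re, Complex.ofReal_re, Complex.re_ofReal_mul, Complex.I_re]
      ring
    have h4 : (ν * (R + θ * Complex.I)).re = ν.re * R - ν.im * θ := by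
      simp
    have h6 : Real.cos θ ≤ 0 :=
      Real.cos_nonpos_of_pi_div_two_le_of_le hθ.1.le (by linarith [hθ.2, Real.pi_pos])
    have h7 : x * (Real.sinh R * Real.cos θ) ≤ 0 :=
      mul_nonpos_of_nonneg_of_nonpos hx.le
        (mul_nonpos_of_nonneg_of_nonpos (Real.sinh_nonneg_iff.2 hR) h6)
    rw [Complex.sub_re, h4, h3]
    have h5 : ν.im * θ ≤ |ν.im| * Real.pi := by
      refine (le_abs_self _).trans ?_
      rw [abs_mul]
      refine mul_le_mul_of_nonneg_left (abs_le.2 ⟨?_, hθ.2⟩) (abs_nonneg _)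
      linarith [hθ.1, Real.pi_pos]
    linarith
  have e := tendsto_nhds_unique
    ((((lim1.const_mul _).sub (lim2.const_mul _)).sub_const _).congr rect)
    (lim3.const_mul (-Complex.I))
  have c : Continuous fun θ : ℝ =>
    Complex.exp ((x * Complex.sin θ - ν * θ) * Complex.I) := by fun_prop
  unfold schlafliSegment schlafliRay besselP
  rw [← intervalIntegral.integral_add_adjacent_intervals
    (c.intervalIntegrable 0 (Real.pi / 2)) (c.intervalIntegrable (Real.pi / 2) Real.pi)]
  linear_combination Complex.I * e + (∫ θ in (Real.pi / 2)..Real.pi,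
        Complex.exp ((x * Complex.sin θ - ν * θ) * Complex.I)) * Complex.I_sq

theorem conj_schlafliRay (ν : ℂ) (x : ℝ) :
    (starRingEnd ℂ) (schlafliRay ((starRingEnd ℂ) ν) x) = schlafliRay ν x := by
  unfold schlafliRay
  rw [← integral_conj]
  congr 1
  funext u
  rw [← Complex.exp_conj]
  congr 1
  simp [← Complex.sinh_conj]

theorem conj_besselP {ν : ℂ} (hν : 0 < ν.re) {x : ℝ} (hx : 0 < x) :
    (starRingEnd ℂ) (besselP ((starRingEnd ℂ) ν) x) =
      (starRingEnd ℂ) (schlafliSegment ((starRingEnd ℂ) ν) x) +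
        Complex.I * Complex.exp (Real.pi * ν * Complex.I) * schlafliRay ν x := by
  rw [← schlafliSegment_sub_schlafliRay (by simpa using hν) hx, map_sub, map_mul, map_mul,
    conj_schlafliRay, ← Complex.exp_conj]
  simp

theorem besselJ_eq_besselP {ν : ℂ} (hν : 0 < ν.re) {x : ℝ} (hx : 0 < x)
    (hs : Complex.sin (Real.pi * ν) ≠ 0) :
    besselJ ν x = (besselP ν x + (starRingEnd ℂ) (besselP ((starRingEnd ℂ) ν) x)) /
      (2 * Real.pi) := by
  rw [besselJ_eq_schlafli hx hs, integral_neg_pi_pi_schlafli, conj_besselP hν hx,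
    ← schlafliSegment_sub_schlafliRay hν hx, Complex.sin]
  ring

/-- Schläfli's formula at `ν` and at `-ν`. The ray at `-ν` stays on its original line, since
shifting would need decay that `Re (-ν) < 0` does not give. -/
theorem besselYQuot_eq_besselP {ν : ℂ} (hν : 0 < ν.re) {x : ℝ} (hx : 0 < x)
    (hs : Complex.sin (Real.pi * ν) ≠ 0) :
    besselYQuot ν x = (besselP ν x - (starRingEnd ℂ) (besselP ((starRingEnd ℂ) ν) x)) /
      (2 * Real.pi * Complex.I) - schlafliRay (-ν) x / Real.pi := by
  have hpi : (Real.pi : ℂ) ≠ 0 := by exact_mod_cast Real.pi_ne_zero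
  have hs' : Complex.sin (Real.pi * -ν) ≠ 0 := by
    rw [mul_neg, Complex.sin_neg]
    exact neg_ne_zero.2 hs
  rw [besselYQuot, div_eq_iff hs, besselJ_eq_schlafli hx hs, besselJ_eq_schlafli hx hs',
    integral_neg_pi_pi_schlafli, integral_neg_pi_pi_schlafli, map_neg, schlafliSegment_neg,
    schlafliSegment_neg, map_mul, ← Complex.exp_conj, conj_besselP hν hx,
    ← schlafliSegment_sub_schlafliRay hν hx, mul_neg, Complex.sin_neg]
  have e1 : (starRingEnd ℂ) (Real.pi * (starRingEnd ℂ) ν * Complex.I) =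
      -(Real.pi * ν) * Complex.I := by simp
  rw [e1, Complex.sin, Complex.cos]
  generalize schlafliSegment ν x = A
  generalize (starRingEnd ℂ) (schlafliSegment ((starRingEnd ℂ) ν) x) = B
  generalize schlafliRay ν x = L
  generalize schlafliRay (-ν) x = M
  generalize Complex.exp (Real.pi * ν * Complex.I) = p
  generalize Complex.exp (-(Real.pi * ν) * Complex.I) = q
  have hI := Complex.I_ne_zero
  field_simp
  ring

/-! ### The segment: phase `x sin θ - σθ`. -/

theorem hasDerivAt_segmentPhase (x σ y : ℝ) :
    HasDerivAt (fun y => x * Real.sin y - σ * y) (x * Real.cos y - σ) y := by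
  simpa using ((Real.hasDerivAt_sin y).const_mul x).fun_sub ((hasDerivAt_id y).const_mul σ)

theorem hasDerivAt_segmentPhase' (x σ y : ℝ) :
    HasDerivAt (fun y => x * Real.cos y - σ) (-(x * Real.sin y)) y := by
  simpa using ((Real.hasDerivAt_cos y).const_mul x).sub_const σ

theorem norm_segmentPhase_le_of_deriv {x σ a b l : ℝ} (hx : 0 < x) (ha : 0 ≤ a) (hab : a ≤ b)
    (hb : b ≤ Real.pi / 2) (hl : 0 < l) (h : ∀ y ∈ Icc a b, l ≤ |x * Real.cos y - σ|) :
    ‖∫ y in a..b, Complex.exp ((x * Real.sin y - σ * y : ℝ) * Complex.I)‖ ≤ 4 / l := by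
  refine norm_integral_cexp_le_of_deriv (hasDerivAt_segmentPhase x σ)
    (hasDerivAt_segmentPhase' x σ) (by fun_prop) hab hl h (Or.inr fun y hy => ?_)
  have : 0 ≤ Real.sin y := Real.sin_nonneg_of_nonneg_of_le_pi (ha.trans hy.1)
    (by linarith [hy.2, Real.pi_pos])
  nlinarith

theorem half_mul_le_sin {y : ℝ} (h0 : 0 ≤ y) (h : y ≤ Real.pi / 2) : y / 2 ≤ Real.sin y := by
  refine le_trans ?_ (Real.mul_le_sin h0 h)
  have : (1 : ℝ) / 2 ≤ 2 / Real.pi := by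
    rw [div_le_div_iff₀ two_pos Real.pi_pos]
    linarith [Real.pi_le_four]
  nlinarith

theorem ten_div_sqrt_half_le {l : ℝ} (hl : 0 < l) : 10 / √(l / 2) ≤ 15 / √l := by
  have h1 : 0 < √l := Real.sqrt_pos.2 hl
  have h2 : 0 < √(l / 2) := Real.sqrt_pos.2 (by linarith)
  rw [div_le_div_iff₀ h2 h1]
  refine abs_le_of_sq_le_sq' ?_ (by positivity) |>.2
  rw [mul_pow, mul_pow, Real.sq_sqrt hl.le, Real.sq_sqrt (by linarith)]
  nlinarith

theorem norm_segmentPhase_le_of_deriv2 {x σ a b δ : ℝ} (hx : 0 < x) (hδ : 0 < δ) (ha : δ ≤ a)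
    (hab : a ≤ b) (hb : b ≤ Real.pi / 2) :
    ‖∫ y in a..b, Complex.exp ((x * Real.sin y - σ * y : ℝ) * Complex.I)‖ ≤
      15 / √(x * δ) := by
  have hl : 0 < x * δ := by positivity
  refine (norm_integral_cexp_le_of_deriv2 (l := x * δ / 2) (hasDerivAt_segmentPhase x σ)
    (hasDerivAt_segmentPhase' x σ) (by fun_prop) hab (by positivity)
    (Or.inr fun y hy => ?_)).trans (ten_div_sqrt_half_le hl)
  have h1 := half_mul_le_sin (by linarith [hy.1]) (hy.2.trans hb)
  have h2 : x * (δ / 2) ≤ x * Real.sin y :=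
    mul_le_mul_of_nonneg_left (by linarith [hy.1]) hx.le
  linarith

/-- The second derivative `-x sin θ` degenerates only at `0`. Beyond `δ` the second derivative test
applies; the piece before `δ` is left to the caller. -/
theorem norm_segmentPhase_le_of_split {x σ b δ B : ℝ} (hx : 0 < x) (hδ : 0 < δ) (hb0 : 0 ≤ b)
    (hb : b ≤ Real.pi / 2)
    (h : ∀ c, 0 ≤ c → c ≤ Real.pi / 2 → c ≤ δ →
      ‖∫ y in (0 : ℝ)..c, Complex.exp ((x * Real.sin y - σ * y : ℝ) * Complex.I)‖ ≤ B) :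
    ‖∫ y in (0 : ℝ)..b, Complex.exp ((x * Real.sin y - σ * y : ℝ) * Complex.I)‖ ≤
      B + 15 / √(x * δ) := by
  have h15 : 0 ≤ 15 / √(x * δ) := by positivity
  rcases le_total b δ with hd | hd
  · linarith [h b hb0 hb hd]
  · have c : Continuous fun y : ℝ =>
      Complex.exp ((x * Real.sin y - σ * y : ℝ) * Complex.I) := by fun_prop
    rw [← intervalIntegral.integral_add_adjacent_intervals (c.intervalIntegrable 0 δ)
      (c.intervalIntegrable δ b)]
    exact (norm_add_le _ _).trans (add_le_add (h δ hδ.le (hd.trans hb) le_rfl)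
      (norm_segmentPhase_le_of_deriv2 hx hδ le_rfl hd hb))

theorem norm_segmentPhase_le_of_le_half {x σ b : ℝ} (hx : 1 ≤ x) (hσ : σ ≤ x / 2) (hb0 : 0 ≤ b)
    (hb : b ≤ Real.pi / 2) :
    ‖∫ y in (0 : ℝ)..b, Complex.exp ((x * Real.sin y - σ * y : ℝ) * Complex.I)‖ ≤
      33 / √x := by
  have hx0 : 0 < x := by linarith
  have hs : 0 < √x := Real.sqrt_pos.2 hx0
  have h1 := norm_segmentPhase_le_of_split (σ := σ) (δ := 1 / 2) (B := 4 / (3 / 8 * x)) hx0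
    (by norm_num) hb0 hb (fun c hc0 hc hcd =>
      norm_segmentPhase_le_of_deriv hx0 le_rfl hc0 hc (by positivity) (fun y hy => by
        have h2 := Real.one_sub_sq_div_two_le_cos (x := y)
        have h3 : 7 / 8 ≤ Real.cos y := by nlinarith [hy.1, hy.2]
        refine le_trans ?_ (le_abs_self _)
        nlinarith))
  refine h1.trans ?_
  have h4 : 4 / (3 / 8 * x) ≤ 11 / √x := by
    rw [div_le_div_iff₀ (by positivity) hs]
    nlinarith [Real.sq_sqrt hx0.le, Real.one_le_sqrt.2 hx]
  have h5 : 15 / √(x * (1 / 2)) ≤ 22 / √x := by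
    have h2 : 0 < √(x / 2) := Real.sqrt_pos.2 (by linarith)
    rw [show x * (1 / 2) = x / 2 by ring, div_le_div_iff₀ h2 hs]
    refine abs_le_of_sq_le_sq' ?_ (by positivity) |>.2
    rw [mul_pow, mul_pow, Real.sq_sqrt hx0.le, Real.sq_sqrt (by linarith)]
    nlinarith
  have : 33 / √x = 11 / √x + 22 / √x := by ring
  linarith

theorem norm_segmentPhase_le_of_two_mul_le {x σ b : ℝ} (hx : 0 < x) (hσ : 2 * x ≤ σ)
    (hb0 : 0 ≤ b) (hb : b ≤ Real.pi / 2) :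
    ‖∫ y in (0 : ℝ)..b, Complex.exp ((x * Real.sin y - σ * y : ℝ) * Complex.I)‖ ≤ 8 / σ := by
  have h1 := norm_segmentPhase_le_of_deriv (σ := σ) (l := σ / 2) hx le_rfl hb0 hb (by linarith)
    (fun y hy => by
      refine le_trans ?_ (neg_le_abs _)
      nlinarith [Real.cos_le_one y])
  refine h1.trans (le_of_eq ?_)
  field_simp
  norm_num

theorem norm_segmentPhase_mul_sqrt_sqrt_le {x σ b : ℝ} (hx : 0 < x) (hσ : |σ - x| ≤ x)
    (hb0 : 0 ≤ b) (hb : b ≤ Real.pi / 2) :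
    ‖∫ y in (0 : ℝ)..b, Complex.exp ((x * Real.sin y - σ * y : ℝ) * Complex.I)‖ *
      √(√(x * |σ - x|)) ≤ 18 := by
  rcases eq_or_ne σ x with rfl | hne
  · simp
  have hd : 0 < |σ - x| := abs_pos.2 (sub_ne_zero.2 hne)
  set d := |σ - x| with hd'
  set D := √(x * d) with hD
  have hD0 : 0 < D := Real.sqrt_pos.2 (by positivity)
  have hDD : D ^ 2 = x * d := Real.sq_sqrt (by positivity)
  set r := √D with hr
  have hr0 : 0 < r := Real.sqrt_pos.2 hD0
  have hrr : r ^ 2 = D := Real.sq_sqrt hD0.le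
  have hxδ : x * (D / x) = D := by field_simp
  -- The choice `δ = √(d/x)` gives `x δ² = d`, so `|φ'| ≥ d/2` on `[0, δ]`. There the integral is at
  -- most `δ` and at most `8/d`, hence at most the geometric mean `√8 / r ≤ 3 / r`.
  have h1 := norm_segmentPhase_le_of_split (σ := σ) (δ := D / x) (B := 3 / r) hx
    (by positivity) hb0 hb (fun c hc0 hc hcd => by
      have n1 : ‖∫ y in (0 : ℝ)..c, Complex.exp ((x * Real.sin y - σ * y : ℝ) * Complex.I)‖ ≤
          D / x := (norm_integral_cexp_le_length _ hc0).trans (by linarith)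
      have n2 : ‖∫ y in (0 : ℝ)..c, Complex.exp ((x * Real.sin y - σ * y : ℝ) * Complex.I)‖ ≤
          4 / (d / 2) := by
        refine norm_segmentPhase_le_of_deriv hx le_rfl hc0 hc (by positivity) fun y hy => ?_
        rcases le_total σ x with hσx | hσx
        · have e1 : d = x - σ := by rw [hd', abs_of_nonpos (by linarith)]; ring
          refine le_trans ?_ (le_abs_self _)
          have h2 := Real.one_sub_sq_div_two_le_cos (x := y)
          have h3 : x * (1 - y ^ 2 / 2) ≤ x * Real.cos y := mul_le_mul_of_nonneg_left h2 hx.le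
          have h4 : y ^ 2 ≤ (D / x) ^ 2 := pow_le_pow_left₀ hy.1 (hy.2.trans hcd) 2
          have h5 : x * (D / x) ^ 2 = d := by
            rw [div_pow, hDD]
            field_simp
          have h6 : x * y ^ 2 ≤ d := h5 ▸ mul_le_mul_of_nonneg_left h4 hx.le
          linarith
        · have e1 : d = σ - x := abs_of_nonneg (by linarith)
          refine le_trans ?_ (neg_le_abs _)
          nlinarith [Real.cos_le_one y]
      rw [le_div_iff₀ hr0]
      refine abs_le_of_sq_le_sq' ?_ (by positivity) |>.2
      rw [mul_pow, hrr, sq]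
      have n3 := mul_le_mul n1 n2 (norm_nonneg _) (by positivity)
      have n4 := mul_le_mul_of_nonneg_right n3 hD0.le
      refine n4.trans ?_
      have : D / x * (4 / (d / 2)) * D = 8 * (D ^ 2 / (x * d)) := by
        field_simp
        norm_num
      rw [this, hDD, div_self (by positivity)]
      norm_num)
  rw [hxδ, ← hr] at h1
  have : 3 / r + 15 / r = 18 / r := by ring
  rw [this] at h1
  rwa [le_div_iff₀ hr0] at h1

theorem norm_segmentPhase_mul_sqrt_sqrt_le' {x σ b : ℝ} (hx : 1 / 2 ≤ x)
    (hb0 : 0 ≤ b) (hb : b ≤ Real.pi / 2) :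
    ‖∫ y in (0 : ℝ)..b, Complex.exp ((x * Real.sin y - σ * y : ℝ) * Complex.I)‖ *
      √(√x) ≤ 17 := by
  have hx0 : 0 < x := by linarith
  set D := √x with hD
  have hD0 : 0 < D := Real.sqrt_pos.2 (by positivity)
  have hDD : D ^ 2 = x := Real.sq_sqrt (by positivity)
  set r := √D with hr
  have hr0 : 0 < r := Real.sqrt_pos.2 hD0
  have hrr : r ^ 2 = D := Real.sq_sqrt hD0.le
  have hxδ : x * (1 / D) = D := by
    rw [← hDD]
    field_simp
  -- The cut `δ = x^(-1/2)` is not optimal, but `x^(-1/4)` is all that is needed.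
  have h1 := norm_segmentPhase_le_of_split (σ := σ) (δ := 1 / D) (B := 1 / D) hx0
    (by positivity) hb0 hb
    (fun c hc0 hc hcd => (norm_integral_cexp_le_length _ hc0).trans (by linarith))
  rw [hxδ, ← hr] at h1
  have h2 : 1 / 2 ≤ r := by
    by_contra! h
    have h3 : D < 1 / 4 := by rw [← hrr]; nlinarith
    nlinarith
  have h4 : 1 / D ≤ 2 / r := by
    rw [div_le_div_iff₀ hD0 hr0, ← hrr]
    nlinarith
  have : 2 / r + 15 / r = 17 / r := by ring
  rw [← le_div_iff₀ hr0]
  linarith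

/-- Inserting the amplitude `exp (t θ)`. -/
theorem norm_segment_le_of_phase {x σ t a b B : ℝ} (ha : 0 ≤ a) (hab : a ≤ b)
    (h : ∀ c ∈ Icc a b,
      ‖∫ y in a..c, Complex.exp ((x * Real.sin y - σ * y : ℝ) * Complex.I)‖ ≤ B) :
    ‖∫ θ in a..b, Complex.exp ((x * Complex.sin θ - (σ + t * Complex.I) * θ) * Complex.I)‖ ≤
      3 * (Real.exp (|t| * b) * B) := by
  have e : ∀ θ : ℝ, Complex.exp ((x * Complex.sin θ - (σ + t * Complex.I) * θ) * Complex.I) =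
      Complex.exp ((x * Real.sin θ - σ * θ : ℝ) * Complex.I) * (Real.exp (t * θ) : ℝ) := by
    intro θ
    push_cast
    rw [← Complex.exp_add]
    congr 1
    linear_combination (-(t * θ : ℂ)) * Complex.I_sq
  simp_rw [e]
  refine norm_integral_mul_le_of_monotone (g' := fun y => t * Real.exp (t * y)) (by fun_prop)
    (fun y => ?_) (by fun_prop) hab ?_ (fun y hy => ?_) h
  · have := ((hasDerivAt_id y).const_mul t).exp
    simpa [mul_comm] using this
  · rcases le_total 0 t with ht | ht
    · exact Or.inl fun y _ => by positivity
    · exact Or.inr fun y _ => mul_nonpos_of_nonpos_of_nonneg ht (Real.exp_pos _).le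
  · rw [abs_of_pos (Real.exp_pos _)]
    refine Real.exp_le_exp.2 ?_
    have h1 : t * y ≤ |t| * y := mul_le_mul_of_nonneg_right (le_abs_self t) (ha.trans hy.1)
    exact h1.trans (mul_le_mul_of_nonneg_left hy.2 (abs_nonneg t))

theorem norm_segment_le_div {x σ t : ℝ} (ht : 0 < |t|) :
    ‖∫ θ in (0 : ℝ)..(Real.pi / 2),
      Complex.exp ((x * Complex.sin θ - (σ + t * Complex.I) * θ) * Complex.I)‖ ≤
      Real.exp (Real.pi / 2 * |t|) / |t| := by
  have hpi : (0 : ℝ) ≤ Real.pi / 2 := by positivity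
  have h1 : ‖∫ θ in (0 : ℝ)..(Real.pi / 2),
      Complex.exp ((x * Complex.sin θ - (σ + t * Complex.I) * θ) * Complex.I)‖ ≤
      ∫ θ in (0 : ℝ)..(Real.pi / 2), Real.exp (|t| * θ) := by
    refine intervalIntegral.norm_integral_le_of_norm_le hpi (Eventually.of_forall fun θ hθ => ?_)
      ((by fun_prop : Continuous fun θ => Real.exp (|t| * θ)).intervalIntegrable _ _)
    rw [Complex.norm_exp]
    refine Real.exp_le_exp.2 ?_
    have : ((x * Complex.sin θ - (σ + t * Complex.I) * θ) * Complex.I).re = t * θ := by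
      rw [← Complex.ofReal_sin]
      simp
    rw [this]
    exact mul_le_mul_of_nonneg_right (le_abs_self t) hθ.1.le
  refine h1.trans ?_
  have hd : ∀ θ ∈ uIcc 0 (Real.pi / 2),
      HasDerivAt (fun θ => Real.exp (|t| * θ) / |t|) (Real.exp (|t| * θ)) θ := by
    intro θ _
    have := (((hasDerivAt_id θ).const_mul |t|).exp).div_const |t|
    simpa [ht.ne'] using this
  rw [intervalIntegral.integral_eq_sub_of_hasDerivAt hd
    ((by fun_prop : Continuous fun θ => Real.exp (|t| * θ)).intervalIntegrable _ _)]
  rw [mul_comm |t| (Real.pi / 2), mul_zero, Real.exp_zero]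
  have : 0 < 1 / |t| := by positivity
  linarith

/-! ### The ray: phase `x cosh u - tu`. -/

theorem hasDerivAt_rayPhase (x t y : ℝ) :
    HasDerivAt (fun y => x * Real.cosh y - t * y) (x * Real.sinh y - t) y := by
  simpa using ((Real.hasDerivAt_cosh y).const_mul x).fun_sub ((hasDerivAt_id y).const_mul t)

theorem hasDerivAt_rayPhase' (x t y : ℝ) :
    HasDerivAt (fun y => x * Real.sinh y - t) (x * Real.cosh y) y := by
  simpa using ((Real.hasDerivAt_sinh y).const_mul x).sub_const t

theorem norm_rayPhase_le_of_deriv2 {x t a b l : ℝ} (hab : a ≤ b) (hl : 0 < l)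
    (h : ∀ y ∈ Icc a b, l ≤ x * Real.cosh y) :
    ‖∫ y in a..b, Complex.exp ((x * Real.cosh y - t * y : ℝ) * Complex.I)‖ ≤ 10 / √l :=
  norm_integral_cexp_le_of_deriv2 (hasDerivAt_rayPhase x t) (hasDerivAt_rayPhase' x t)
    (by fun_prop) hab hl (Or.inl h)

theorem norm_rayPhase_le_of_deriv {x t a b l : ℝ} (hx : 0 < x) (hab : a ≤ b) (hl : 0 < l)
    (h : ∀ y ∈ Icc a b, l ≤ |x * Real.sinh y - t|) :
    ‖∫ y in a..b, Complex.exp ((x * Real.cosh y - t * y : ℝ) * Complex.I)‖ ≤ 4 / l :=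
  norm_integral_cexp_le_of_deriv (hasDerivAt_rayPhase x t) (hasDerivAt_rayPhase' x t)
    (by fun_prop) hab hl h (Or.inl fun y _ => by positivity)

theorem norm_rayPhase_le_of_one_le_abs {x t b : ℝ} (hx : 0 < x) (ht : 1 ≤ |t|) (hb : 0 ≤ b) :
    ‖∫ y in (0 : ℝ)..b, Complex.exp ((x * Real.cosh y - t * y : ℝ) * Complex.I)‖ ≤
      23 / √|t| := by
  have ht0 : 0 < |t| := by linarith
  have hs : 0 < √|t| := Real.sqrt_pos.2 ht0
  have h8 : 8 / |t| ≤ 8 / √|t| := by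
    rw [div_le_div_iff₀ ht0 hs]
    nlinarith [Real.sq_sqrt ht0.le, Real.one_le_sqrt.2 ht]
  have h23 : 23 / √|t| = 8 / √|t| + 15 / √|t| := by ring
  have h15 : 0 ≤ 15 / √|t| := by positivity
  rcases le_total t 0 with htn | htp
  · have h1 := norm_rayPhase_le_of_deriv (t := t) (l := |t| / 2) hx hb (by linarith)
      (fun y hy => by
        have : 0 ≤ Real.sinh y := Real.sinh_nonneg_iff.2 hy.1
        refine le_trans ?_ (le_abs_self _)
        rw [abs_of_nonpos htn] at ht0 ⊢
        nlinarith [mul_nonneg hx.le this])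
    have e : 4 / (|t| / 2) = 8 / |t| := by field_simp; norm_num
    linarith
  · have hta : |t| = t := abs_of_nonneg htp
    -- At `c` one has `x sinh c = t/2`. Before `c` this gives `|φ'| ≥ t/2`; after `c` it gives `φ''
    -- = x cosh y ≥ x sinh c = t/2`. The bound is therefore uniform in `x`.
    set c := Real.arsinh (t / (2 * x)) with hc
    have hsc : x * Real.sinh c = t / 2 := by
      rw [hc, Real.sinh_arsinh]
      field_simp
    have hc0 : 0 ≤ c := Real.arsinh_nonneg_iff.2 (by positivity)
    have n1 : ∀ p, 0 ≤ p → p ≤ c →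
        ‖∫ y in (0 : ℝ)..p, Complex.exp ((x * Real.cosh y - t * y : ℝ) * Complex.I)‖ ≤
          8 / |t| := by
      intro p hp hpc
      have h1 := norm_rayPhase_le_of_deriv (t := t) (l := |t| / 2) hx hp (by linarith)
        (fun y hy => by
          have h2 : Real.sinh y ≤ Real.sinh c := Real.sinh_le_sinh.2 (hy.2.trans hpc)
          refine le_trans ?_ (neg_le_abs _)
          rw [hta]
          nlinarith [mul_le_mul_of_nonneg_left h2 hx.le])
      have e : 4 / (|t| / 2) = 8 / |t| := by field_simp; norm_num
      linarith
    rcases le_total b c with hbc | hbc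
    · linarith [n1 b hb hbc]
    · have n2 : ‖∫ y in c..b, Complex.exp ((x * Real.cosh y - t * y : ℝ) * Complex.I)‖ ≤
          15 / √|t| := by
        refine (norm_rayPhase_le_of_deriv2 (l := |t| / 2) hbc (by linarith)
          (fun y hy => ?_)).trans (ten_div_sqrt_half_le ht0)
        have h2 : Real.sinh c ≤ Real.sinh y := Real.sinh_le_sinh.2 hy.1
        have h3 := (Real.sinh_lt_cosh y).le
        rw [hta, ← hsc]
        exact mul_le_mul_of_nonneg_left (h2.trans h3) hx.le
      have c' : Continuous fun y : ℝ =>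
        Complex.exp ((x * Real.cosh y - t * y : ℝ) * Complex.I) := by fun_prop
      rw [← intervalIntegral.integral_add_adjacent_intervals (c'.intervalIntegrable 0 c)
        (c'.intervalIntegrable c b)]
      refine (norm_add_le _ _).trans ?_
      linarith [n1 c hc0 le_rfl]

theorem norm_ray_le_of_phase {x σ t B : ℝ} (hσ : 0 < σ)
    (h : ∀ c, 0 ≤ c →
      ‖∫ y in (0 : ℝ)..c, Complex.exp ((x * Real.cosh y - t * y : ℝ) * Complex.I)‖ ≤ B) :
    ‖∫ u in Ioi (0 : ℝ),
      Complex.exp (x * Complex.cosh u * Complex.I - (σ + t * Complex.I) * u)‖ ≤ 3 * B := by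
  have lim := intervalIntegral_tendsto_integral_Ioi 0
    (integrableOn_besselP (ν := σ + t * Complex.I) (by simpa using hσ) x) tendsto_id
  refine le_of_tendsto lim.norm ?_
  filter_upwards [eventually_ge_atTop 0] with R hR
  have e : ∀ u : ℝ, Complex.exp (x * Complex.cosh u * Complex.I - (σ + t * Complex.I) * u) =
      Complex.exp ((x * Real.cosh u - t * u : ℝ) * Complex.I) * (Real.exp (-σ * u) : ℝ) := by
    intro θ
    push_cast
    rw [← Complex.exp_add]
    congr 1
    ring
  simp_rw [e]
  have := norm_integral_mul_le_of_monotone (a := 0) (b := R) (A := 1) (B := B)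
    (f := fun u : ℝ => Complex.exp ((x * Real.cosh u - t * u : ℝ) * Complex.I))
    (g := fun u => Real.exp (-σ * u)) (g' := fun y => -σ * Real.exp (-σ * y)) (by fun_prop)
    (fun y => ?_) (by fun_prop) hR ?_ (fun y hy => ?_) (fun y hy => h y hy.1)
  · simpa using this
  · have := ((hasDerivAt_id y).const_mul (-σ)).exp
    simpa [mul_comm] using this
  · exact Or.inr fun y _ =>
      mul_nonpos_of_nonpos_of_nonneg (by linarith) (Real.exp_pos _).le
  · rw [abs_of_pos (Real.exp_pos _)]
    refine Real.exp_le_one_iff.2 ?_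
    nlinarith [hy.1]

theorem norm_ray_le_inv {x σ t : ℝ} (hσ : 0 < σ) :
    ‖∫ u in Ioi (0 : ℝ),
      Complex.exp (x * Complex.cosh u * Complex.I - (σ + t * Complex.I) * u)‖ ≤ 1 / σ := by
  refine (norm_integral_le_integral_norm _).trans (le_of_eq ?_)
  have e : ∀ u : ℝ,
      ‖Complex.exp (x * Complex.cosh u * Complex.I - (σ + t * Complex.I) * u)‖ =
        Real.exp (-σ * u) := by
    intro u
    rw [Complex.norm_exp, ← Complex.ofReal_cosh, ← Complex.ofReal_mul]
    simp
  simp_rw [e]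
  rw [integral_exp_mul_Ioi (by linarith)]
  simp

/-! ### Fourth-power bounds in all ranges of the parameters, and the bound for `besselP`. -/

theorem one_add_abs_le_five_mul_sq {σ t x M : ℝ} (hσ : 0 ≤ σ) (hx : 0 ≤ x) (hM : 1 ≤ M)
    (h1 : σ ≤ M) (h2 : |t| ≤ M) (h3 : x ≤ M) :
    1 + |x ^ 2 - σ ^ 2 + t ^ 2| + σ * |t| ≤ 5 * M ^ 2 := by
  have h4 : |x ^ 2 - σ ^ 2 + t ^ 2| ≤ x ^ 2 + σ ^ 2 + t ^ 2 :=
    abs_le.2 ⟨by nlinarith, by nlinarith⟩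
  have h5 : t ^ 2 ≤ M ^ 2 := by
    rw [← sq_abs]
    exact pow_le_pow_left₀ (abs_nonneg t) h2 2
  have h6 : σ * |t| ≤ M * M := mul_le_mul h1 h2 (abs_nonneg t) (by linarith)
  nlinarith

theorem pow_four_mul_le_of_mul_sqrt_le {σ t x M y K : ℝ} (hσ : 0 ≤ σ) (hx : 0 ≤ x)
    (hM : 1 ≤ M) (h1 : σ ≤ M) (h2 : |t| ≤ M) (h3 : x ≤ M) (hy : 0 ≤ y) (h : y * √M ≤ K) :
    y ^ 4 * (1 + |x ^ 2 - σ ^ 2 + t ^ 2| + σ * |t|) ≤ 5 * K ^ 4 := by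
  have e := pow_le_pow_left₀ (by positivity) h 4
  have e2 : (√M) ^ 4 = M ^ 2 := by
    rw [show 4 = 2 * 2 by norm_num, pow_mul, Real.sq_sqrt (by linarith)]
  rw [mul_pow, e2] at e
  have := mul_le_mul_of_nonneg_left (one_add_abs_le_five_mul_sq hσ hx hM h1 h2 h3)
    (pow_nonneg hy 4)
  linarith

/-- The ray has no degenerate point, since `φ'' = x cosh u ≥ x`. Whichever of `σ`, `|t|`, `x` is
largest, it gives `M^(-1/2)`: by absolute values, by `norm_rayPhase_le_of_one_le_abs`, or by the
second derivative test. -/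
theorem norm_ray_pow_four_mul_le {σ t x : ℝ} (hσ : 0 < σ) (hx : 0 < x)
    (h : 1 ≤ max σ (max |t| x)) :
    ‖∫ u in Ioi (0 : ℝ),
      Complex.exp (x * Complex.cosh u * Complex.I - (σ + t * Complex.I) * u)‖ ^ 4 *
      (1 + |x ^ 2 - σ ^ 2 + t ^ 2| + σ * |t|) ≤ 5 * 69 ^ 4 := by
  have hM := h
  set M := max σ (max |t| x) with hMdef
  have h1 : σ ≤ M := le_max_left _ _
  have h2 : |t| ≤ M := (le_max_left _ _).trans (le_max_right _ _)
  have h3 : x ≤ M := (le_max_right _ _).trans (le_max_right _ _)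
  have hM0 : 0 < M := by linarith
  have hs : 0 < √M := Real.sqrt_pos.2 hM0
  refine pow_four_mul_le_of_mul_sqrt_le hσ.le hx.le hM h1 h2 h3 (norm_nonneg _) ?_
  rw [← le_div_iff₀ hs]
  have hcase : M = σ ∨ M = |t| ∨ M = x := by
    rcases max_choice σ (max |t| x) with h | h
    · exact Or.inl h
    · rcases max_choice |t| x with h' | h'
      · exact Or.inr (Or.inl (h.trans h'))
      · exact Or.inr (Or.inr (h.trans h'))
  rcases hcase with e | e | e
  · refine (norm_ray_le_inv hσ).trans ?_
    rw [← e, div_le_div_iff₀ hM0 hs]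
    nlinarith [Real.sq_sqrt hM0.le, Real.one_le_sqrt.2 hM]
  · refine (norm_ray_le_of_phase hσ (B := 23 / √|t|)
      fun c hc => norm_rayPhase_le_of_one_le_abs hx (e ▸ hM) hc).trans (le_of_eq ?_)
    rw [e]
    ring
  · refine (norm_ray_le_of_phase hσ (B := 10 / √x)
      fun c hc => norm_rayPhase_le_of_deriv2 hc hx fun y hy => ?_).trans ?_
    · nlinarith [Real.one_le_cosh y]
    · rw [e, show 3 * (10 / √x) = 30 / √x by ring]
      gcongr
      norm_num

/-- The segment is cut at `π/4`. On the far half the phase is nondegenerate and gives `x^(-1/2)`. On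
the near half the amplitude is at most `F = exp (π|t|/4)`, and the unused factor `F` absorbs the
powers of `1 + |t|` that separate `N` from `1 + x|σ - x| + x`, for which the bounds with exponent
`-1/4` suffice. -/
theorem norm_segment_pow_four_mul_le_turning {σ t x : ℝ} (hx : 1 / 2 ≤ x) (h1 : x / 2 ≤ σ)
    (h2 : σ ≤ 2 * x) (ht : |t| ≤ 2 * x) :
    ‖∫ θ in (0 : ℝ)..(Real.pi / 2),
      Complex.exp ((x * Complex.sin θ - (σ + t * Complex.I) * θ) * Complex.I)‖ ^ 4 *
      (1 + |x ^ 2 - σ ^ 2 + t ^ 2| + σ * |t|) ≤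
      10 ^ 10 * Real.exp (Real.pi / 2 * |t|) ^ 4 := by
  have hx0 : 0 < x := by linarith
  have hpi := Real.pi_pos
  have hd : |σ - x| ≤ x := abs_le.2 ⟨by linarith, by linarith⟩
  set E := Real.exp (Real.pi / 2 * |t|) with hE
  have hE0 : 0 < E := Real.exp_pos _
  set F := Real.exp (|t| * (Real.pi / 4)) with hF
  have hF0 : 0 < F := Real.exp_pos _
  have hEF : E = F * F := by
    rw [hE, hF, ← Real.exp_add]
    congr 1
    ring
  have hFt : 1 + |t| ≤ F ^ 2 := by
    rw [hF, ← Real.exp_nat_mul]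
    refine le_trans ?_ (Real.add_one_le_exp _)
    push_cast
    nlinarith [Real.pi_gt_three, abs_nonneg t]
  have c : Continuous fun θ : ℝ =>
    Complex.exp ((x * Complex.sin θ - (σ + t * Complex.I) * θ) * Complex.I) := by fun_prop
  rw [← intervalIntegral.integral_add_adjacent_intervals
    (c.intervalIntegrable 0 (Real.pi / 4)) (c.intervalIntegrable _ _)]
  set S₁ := ∫ θ in (0 : ℝ)..(Real.pi / 4),
      Complex.exp ((x * Complex.sin θ - (σ + t * Complex.I) * θ) * Complex.I) with hS₁
  set S₂ := ∫ θ in (Real.pi / 4)..(Real.pi / 2),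
      Complex.exp ((x * Complex.sin θ - (σ + t * Complex.I) * θ) * Complex.I) with hS₂
  set N := 1 + |x ^ 2 - σ ^ 2 + t ^ 2| + σ * |t| with hN
  have hN0 : 0 ≤ N := by
    have : 0 ≤ σ * |t| := mul_nonneg (by linarith) (abs_nonneg t)
    positivity
  have hsqrt4 : ∀ y : ℝ, 0 ≤ y → √(√y) ^ 4 = y := fun y hy => by
    rw [show 4 = 2 * 2 by norm_num, pow_mul, Real.sq_sqrt (Real.sqrt_nonneg _),
      Real.sq_sqrt hy]
  have a1 : ‖S₁‖ ^ 4 * (x * |σ - x|) ≤ 54 ^ 4 * F ^ 4 := by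
    have : ‖S₁‖ * √(√(x * |σ - x|)) ≤ 54 * F := by
      rcases eq_or_ne σ x with e | hne
      · rw [e]
        simp
        positivity
      have hp : 0 < √(√(x * |σ - x|)) := by
        have : 0 < |σ - x| := abs_pos.2 (sub_ne_zero.2 hne)
        positivity
      have := norm_segment_le_of_phase (x := x) (σ := σ) (t := t) (a := 0) (b := Real.pi / 4)
        (B := 18 / √(√(x * |σ - x|))) le_rfl (by positivity) fun c hc => by
          rw [le_div_iff₀ hp]
          exact norm_segmentPhase_mul_sqrt_sqrt_le hx0 hd hc.1 (by linarith [hc.2])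
      rw [← le_div_iff₀ hp]
      refine this.trans (le_of_eq ?_)
      ring
    have := pow_le_pow_left₀ (by positivity) this 4
    rwa [mul_pow, hsqrt4 _ (by positivity), mul_pow] at this
  have a2 : ‖S₁‖ ^ 4 * x ≤ 54 ^ 4 * F ^ 4 := by
    have : ‖S₁‖ * √(√x) ≤ 54 * F := by
      have hp : 0 < √(√x) := by positivity
      have := norm_segment_le_of_phase (x := x) (σ := σ) (t := t) (a := 0) (b := Real.pi / 4)
        (B := 18 / √(√x)) le_rfl (by positivity) fun c hc => by
          rw [le_div_iff₀ hp]
          linarith [norm_segmentPhase_mul_sqrt_sqrt_le' (σ := σ) hx hc.1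
            (by linarith [hc.2] : c ≤ Real.pi / 2)]
      rw [← le_div_iff₀ hp]
      refine this.trans (le_of_eq ?_)
      ring
    have := pow_le_pow_left₀ (by positivity) this 4
    rwa [mul_pow, hsqrt4 _ (by positivity), mul_pow] at this
  have a3 : ‖S₁‖ ^ 4 * N ≤ 12 * 54 ^ 4 * E ^ 4 := by
    have hN1 : N ≤ 3 * (1 + |t|) ^ 2 * (1 + x * |σ - x| + x) := by
      have b1 : |x ^ 2 - σ ^ 2 + t ^ 2| ≤ 3 * (x * |σ - x|) + t ^ 2 := by
        refine (abs_add_le _ _).trans ?_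
        rw [abs_of_nonneg (sq_nonneg t)]
        have : x ^ 2 - σ ^ 2 = -((x + σ) * (σ - x)) := by ring
        rw [this, abs_neg, abs_mul, abs_of_nonneg (by linarith : 0 ≤ x + σ)]
        nlinarith [abs_nonneg (σ - x)]
      have b2 : σ * |t| ≤ 2 * x * |t| := mul_le_mul_of_nonneg_right h2 (abs_nonneg t)
      have b3 : 0 ≤ x * |σ - x| := by positivity
      have b4 := abs_nonneg t
      have b0 := sq_abs t
      have b5 : 0 ≤ x * |t| := by positivity
      have b6 : 0 ≤ (2 * |t| + |t| ^ 2) * (x * |σ - x|) := by positivity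
      have b7 : 0 ≤ x * |t| ^ 2 := by positivity
      have b8 := sq_nonneg |t|
      have b9 : 3 * (1 + |t|) ^ 2 * (1 + x * |σ - x| + x) = 3 * (1 + 2 * |t| + |t| ^ 2 +
        x * |σ - x| + (2 * |t| + |t| ^ 2) * (x * |σ - x|) + x + 2 * (x * |t|) +
        x * |t| ^ 2) := by ring
      rw [hN, b9]
      linarith
    have hN2 : 1 + x * |σ - x| + x ≤ x * |σ - x| + 3 * x := by linarith
    have hN3 : N ≤ 3 * (F ^ 4) * (x * |σ - x| + 3 * x) := by
      refine hN1.trans ?_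
      have : (1 + |t|) ^ 2 ≤ F ^ 4 := by
        have := pow_le_pow_left₀ (by positivity) hFt 2
        rwa [← pow_mul] at this
      gcongr
    calc ‖S₁‖ ^ 4 * N ≤ ‖S₁‖ ^ 4 * (3 * (F ^ 4) * (x * |σ - x| + 3 * x)) := by gcongr
      _ = 3 * F ^ 4 * (‖S₁‖ ^ 4 * (x * |σ - x|) + 3 * (‖S₁‖ ^ 4 * x)) := by ring
      _ ≤ 3 * F ^ 4 * (54 ^ 4 * F ^ 4 + 3 * (54 ^ 4 * F ^ 4)) := by gcongr
      _ = 12 * 54 ^ 4 * E ^ 4 := by rw [hEF]; ring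
  have a4 : ‖S₂‖ ^ 4 * N ≤ 17 * 60 ^ 4 * E ^ 4 := by
    have hp : 0 < √x := Real.sqrt_pos.2 hx0
    have : ‖S₂‖ * √x ≤ 60 * E := by
      have := norm_segment_le_of_phase (x := x) (σ := σ) (t := t) (a := Real.pi / 4)
        (b := Real.pi / 2) (B := 20 / √x) (by positivity) (by linarith) fun c hc => by
          refine (norm_segmentPhase_le_of_deriv2 (δ := Real.pi / 4) hx0 (by positivity) le_rfl
            hc.1 hc.2).trans ?_
          rw [div_le_div_iff₀ (Real.sqrt_pos.2 (by positivity)) hp, Real.sqrt_mul hx0.le]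
          have : 3 / 4 ≤ √(Real.pi / 4) := by
            apply Real.le_sqrt_of_sq_le
            linarith [Real.pi_gt_three]
          nlinarith
      rw [← le_div_iff₀ hp]
      refine this.trans (le_of_eq ?_)
      rw [hE, mul_comm |t|]
      ring
    have := pow_le_pow_left₀ (by positivity) this 4
    rw [mul_pow, show 4 = 2 * 2 by norm_num, pow_mul (√x), Real.sq_sqrt hx0.le] at this
    have hN4 : N ≤ 17 * x ^ 2 := by
      have h4 : |x ^ 2 - σ ^ 2 + t ^ 2| ≤ x ^ 2 + σ ^ 2 + t ^ 2 :=
        abs_le.2 ⟨by nlinarith, by nlinarith⟩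
      have h5 : t ^ 2 ≤ (2 * x) ^ 2 := by
        rw [← sq_abs]
        exact pow_le_pow_left₀ (abs_nonneg t) ht 2
      have h6 : σ * |t| ≤ (2 * x) * (2 * x) := mul_le_mul h2 ht (abs_nonneg t) (by linarith)
      nlinarith
    calc ‖S₂‖ ^ 4 * N ≤ ‖S₂‖ ^ 4 * (17 * x ^ 2) := by gcongr
      _ = 17 * (‖S₂‖ ^ (2 * 2) * x ^ 2) := by ring
      _ ≤ 17 * (60 * E) ^ (2 * 2) := by gcongr
      _ = 17 * 60 ^ 4 * E ^ 4 := by ring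
  have a5 : ‖S₁ + S₂‖ ^ 4 ≤ 8 * (‖S₁‖ ^ 4 + ‖S₂‖ ^ 4) := by
    refine (pow_le_pow_left₀ (norm_nonneg _) (norm_add_le _ _) 4).trans ?_
    have := add_pow_le (norm_nonneg S₁) (norm_nonneg S₂) 4
    norm_num at this
    exact this
  calc ‖S₁ + S₂‖ ^ 4 * N ≤ 8 * (‖S₁‖ ^ 4 + ‖S₂‖ ^ 4) * N := by gcongr
    _ = 8 * (‖S₁‖ ^ 4 * N + ‖S₂‖ ^ 4 * N) := by ring
    _ ≤ 8 * (12 * 54 ^ 4 * E ^ 4 + 17 * 60 ^ 4 * E ^ 4) := by gcongr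
    _ ≤ 10 ^ 10 * E ^ 4 := by nlinarith [pow_pos hE0 4]

theorem norm_segment_pow_four_mul_le {σ t x : ℝ} (hσ : 0 < σ) (hx : 0 < x)
    (h : 1 ≤ max σ (max |t| x)) :
    ‖∫ θ in (0 : ℝ)..(Real.pi / 2),
      Complex.exp ((x * Complex.sin θ - (σ + t * Complex.I) * θ) * Complex.I)‖ ^ 4 *
      (1 + |x ^ 2 - σ ^ 2 + t ^ 2| + σ * |t|) ≤
      10 ^ 10 * Real.exp (Real.pi / 2 * |t|) ^ 4 := by
  have hM := h
  set M := max σ (max |t| x) with hMdef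
  have h1 : σ ≤ M := le_max_left _ _
  have h2 : |t| ≤ M := (le_max_left _ _).trans (le_max_right _ _)
  have h3 : x ≤ M := (le_max_right _ _).trans (le_max_right _ _)
  have hM0 : 0 < M := by linarith
  have hs : 0 < √M := Real.sqrt_pos.2 hM0
  have hs1 : 1 ≤ √M := Real.one_le_sqrt.2 hM
  have hss : √M ^ 2 = M := Real.sq_sqrt hM0.le
  have hpi := Real.pi_pos
  by_cases hturn : x / 2 ≤ σ ∧ σ ≤ 2 * x ∧ |t| ≤ 2 * x
  -- In the turning range each of `σ`, `|t|` is at most `2x`, so `M ≥ 1` forces `x ≥ 1/2`.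
  · obtain ⟨k1, k2, k3⟩ := hturn
    refine norm_segment_pow_four_mul_le_turning ?_ k1 k2 k3
    rcases le_max_iff.1 h with h | h
    · linarith
    · rcases le_max_iff.1 h with h | h <;> linarith
  set E := Real.exp (Real.pi / 2 * |t|) with hE
  have hE0 : 0 < E := Real.exp_pos _
  suffices hk : ‖∫ θ in (0 : ℝ)..(Real.pi / 2),
      Complex.exp ((x * Complex.sin θ - (σ + t * Complex.I) * θ) * Complex.I)‖ * √M ≤
      99 * E by
    refine (pow_four_mul_le_of_mul_sqrt_le hσ.le hx.le hM h1 h2 h3 (norm_nonneg _) hk).trans ?_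
    nlinarith [pow_pos hE0 4]
  rw [← le_div_iff₀ hs]
  have hcase : M = σ ∨ M = |t| ∨ M = x := by
    rcases max_choice σ (max |t| x) with h | h
    · exact Or.inl h
    · rcases max_choice |t| x with h' | h'
      · exact Or.inr (Or.inl (h.trans h'))
      · exact Or.inr (Or.inr (h.trans h'))
  have hinv : 1 / M ≤ 1 / √M := by
    rw [div_le_div_iff₀ hM0 hs]
    nlinarith
  rcases hcase with e | e | e
  · have hσx : 2 * x ≤ σ := by
      by_contra! hlt
      exact hturn ⟨by linarith, hlt.le, by linarith⟩
    refine (norm_segment_le_of_phase (B := 8 / σ) le_rfl (by positivity) fun c hc =>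
      norm_segmentPhase_le_of_two_mul_le hx hσx hc.1 hc.2).trans ?_
    rw [mul_comm |t|, ← hE, ← e]
    have : 3 * (E * (8 / M)) = 24 * E * (1 / M) := by ring
    rw [this, show 99 * E / √M = 99 * E * (1 / √M) by ring]
    gcongr
    norm_num
  · refine (norm_segment_le_div (e ▸ hM0)).trans ?_
    rw [← hE, ← e, show E / M = 1 * E * (1 / M) by ring,
      show 99 * E / √M = 99 * E * (1 / √M) by ring]
    gcongr
    norm_num
  · have hσx : σ ≤ x / 2 := by
      by_contra! hlt
      exact hturn ⟨hlt.le, by linarith, by linarith⟩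
    refine (norm_segment_le_of_phase (B := 33 / √x) le_rfl (by positivity) fun c hc =>
      norm_segmentPhase_le_of_le_half (e ▸ hM) hσx hc.1 hc.2).trans (le_of_eq ?_)
    rw [mul_comm |t|, ← hE, ← e]
    ring

/-- Uniform bound for `besselP` in the half-plane `0 < Re ν`, away from `(ν, x) = 0`. -/
theorem norm_besselP_le {σ t x : ℝ} (hσ : 0 < σ) (hx : 0 < x) (h : 1 ≤ max σ (max |t| x)) :
    ‖besselP (σ + t * Complex.I) x‖ ≤ 1000 *
      ((1 + |x ^ 2 - σ ^ 2 + t ^ 2| + σ * |t|) ^ (-(1 / 4) : ℝ) *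
        Real.exp (Real.pi / 2 * |t|)) := by
  have hs := norm_segment_pow_four_mul_le (t := t) hσ hx h
  have hr := norm_ray_pow_four_mul_le (t := t) hσ hx h
  set N := 1 + |x ^ 2 - σ ^ 2 + t ^ 2| + σ * |t| with hN
  have hN0 : 0 < N := by positivity
  set E := Real.exp (Real.pi / 2 * |t|) with hE
  have hE0 : 0 < E := Real.exp_pos _
  refine le_of_pow_le_pow_left₀ (n := 4) (by norm_num) (by positivity) ?_
  have e1 : (N ^ (-(1 / 4) : ℝ)) ^ 4 = N⁻¹ := by
    rw [← Real.rpow_natCast, ← Real.rpow_mul hN0.le, ← Real.rpow_neg_one]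
    norm_num
  rw [mul_pow, mul_pow, e1]
  unfold besselP
  set S := ∫ θ in (0 : ℝ)..(Real.pi / 2),
      Complex.exp ((x * Complex.sin θ - (σ + t * Complex.I) * θ) * Complex.I)
  set R := ∫ u in Ioi (0 : ℝ),
      Complex.exp (x * Complex.cosh u * Complex.I - (σ + t * Complex.I) * u)
  -- The factor in front of the ray has modulus `exp (πt/2)`; this is the gain over the ray at
  -- height `π`.
  have h1 : ‖Complex.I * Complex.exp (-(Real.pi / 2 * (σ + t * Complex.I)) * Complex.I) * R‖ ≤
      E * ‖R‖ := by
    rw [norm_mul, norm_mul, Complex.norm_I, one_mul, Complex.norm_exp]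
    refine mul_le_mul_of_nonneg_right (Real.exp_le_exp.2 ?_) (norm_nonneg _)
    have : (-((Real.pi / 2 : ℂ) * (σ + t * Complex.I)) * Complex.I).re = Real.pi / 2 * t := by
      have : -((Real.pi / 2 : ℂ) * (σ + t * Complex.I)) * Complex.I =
          ((Real.pi / 2 * t : ℝ) : ℂ) + ((-(Real.pi / 2 * σ) : ℝ) : ℂ) * Complex.I := by
        push_cast
        linear_combination (-(Real.pi / 2 * t : ℂ)) * Complex.I_sq
      rw [this, Complex.add_re, Complex.ofReal_re, Complex.re_ofReal_mul, Complex.I_re]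
      ring
    rw [this]
    exact mul_le_mul_of_nonneg_left (le_abs_self t) (by positivity)
  have h2 := (norm_sub_le S
    (Complex.I * Complex.exp (-(Real.pi / 2 * (σ + t * Complex.I)) * Complex.I) * R)).trans
    (add_le_add_right h1 ‖S‖)
  have h3 := pow_le_pow_left₀ (norm_nonneg _) h2 4
  have h4 := add_pow_le (norm_nonneg S) (by positivity : 0 ≤ E * ‖R‖) 4
  norm_num only at h4
  refine (h3.trans h4).trans ?_
  rw [mul_left_comm, ← div_eq_inv_mul, le_div_iff₀ hN0]
  calc 8 * (‖S‖ ^ 4 + (E * ‖R‖) ^ 4) * N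
      = 8 * (‖S‖ ^ 4 * N + E ^ 4 * (‖R‖ ^ 4 * N)) := by ring
    _ ≤ 8 * (10 ^ 10 * E ^ 4 + E ^ 4 * (5 * 69 ^ 4)) := by gcongr
    _ ≤ 1000 ^ 4 * E ^ 4 := by nlinarith [pow_pos hE0 4]

/-! ### Bounds for `J_ν` and `Y_ν` with `Re ν > 0`. -/

theorem conj_add_mul_I (σ t : ℝ) :
    (starRingEnd ℂ) ((σ : ℂ) + t * Complex.I) = σ + (-t : ℝ) * Complex.I := by
  simp

theorem norm_besselP_pair_le {σ t x : ℝ} (hσ : 0 < σ) (hx : 0 < x)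
    (h : 1 ≤ max σ (max |t| x)) :
    ‖besselP (σ + t * Complex.I) x‖ +
      ‖(starRingEnd ℂ) (besselP ((starRingEnd ℂ) (σ + t * Complex.I)) x)‖ ≤ 2000 *
      ((1 + |x ^ 2 - σ ^ 2 + t ^ 2| + σ * |t|) ^ (-(1 / 4) : ℝ) *
        Real.exp (Real.pi / 2 * |t|)) := by
  have h1 := norm_besselP_le hσ hx h
  have h2 := norm_besselP_le (t := -t) hσ hx (by rwa [abs_neg])
  rw [abs_neg, neg_sq] at h2
  rw [conj_add_mul_I, Complex.norm_conj]
  linarith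

theorem norm_besselJ_le_of_one_le_max {σ t x : ℝ} (hσ : 0 < σ) (hx : 0 < x)
    (h : 1 ≤ max σ (max |t| x)) (hs : Complex.sin (Real.pi * (σ + t * Complex.I)) ≠ 0) :
    ‖besselJ (σ + t * Complex.I) x‖ ≤ 1000 *
      ((1 + |x ^ 2 - σ ^ 2 + t ^ 2| + σ * |t|) ^ (-(1 / 4) : ℝ) *
        Real.exp (Real.pi / 2 * |t|)) := by
  have h1 := norm_besselP_pair_le hσ hx h
  rw [besselJ_eq_besselP (by simpa using hσ) hx hs, norm_div]
  have h2 : ‖(2 * Real.pi : ℂ)‖ = 2 * Real.pi := by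
    simp [abs_of_pos Real.pi_pos]
  rw [h2, div_le_iff₀ (by positivity)]
  refine (norm_add_le _ _).trans (h1.trans ?_)
  set B := (1 + |x ^ 2 - σ ^ 2 + t ^ 2| + σ * |t|) ^ (-(1 / 4) : ℝ) *
        Real.exp (Real.pi / 2 * |t|)
  have : 0 ≤ B := by positivity
  nlinarith [Real.pi_gt_three]

theorem norm_schlafliRay_neg_le {ν : ℂ} {x : ℝ} (hx : 1 ≤ x) (hν : ν.re ≤ x / 2 + 2) :
    ‖schlafliRay (-ν) x‖ ≤ 4 * Real.exp 6 / x := by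
  have hx4 : 0 < x / 4 := by linarith
  have h1 : ‖schlafliRay (-ν) x‖ ≤ ∫ u in Ioi (0 : ℝ), Real.exp 6 * Real.exp (-(x / 4) * u) := by
    refine norm_integral_le_of_norm_le ((exp_neg_integrableOn_Ioi 0 hx4).const_mul _) ?_
    filter_upwards [ae_restrict_mem measurableSet_Ioi] with u hu
    have hu0 : (0 : ℝ) < u := hu
    rw [Complex.norm_exp, ← Real.exp_add]
    refine Real.exp_le_exp.2 ?_
    rw [← Complex.ofReal_sinh, Complex.sub_re, Complex.neg_re, Complex.re_ofReal_mul,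
      Complex.ofReal_re, Complex.re_mul_ofReal, Complex.neg_re]
    have h2 : u ≤ Real.sinh u := Real.self_le_sinh_iff.2 hu0.le
    have h3 : u / 2 + u ^ 2 / 4 ≤ Real.sinh u := by
      rw [Real.sinh_eq]
      have := Real.quadratic_le_exp_of_nonneg hu0.le
      have h4 : Real.exp (-u) ≤ 1 := Real.exp_le_one_iff.2 (by linarith)
      linarith
    have h5 : Real.sinh u - 3 / 4 * u ≤ x * (Real.sinh u - 3 / 4 * u) := by
      nlinarith
    have h6 : ν.re * u ≤ (x / 2 + 2) * u := mul_le_mul_of_nonneg_right hν hu0.le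
    -- After reduction to `x = 1` the exponent plus `xu/4` is at most `9u/4 - u²/4`, whose maximum,
    -- at `u = 9/2`, is `81/16 < 6`.
    nlinarith [sq_nonneg (u - 9 / 2)]
  refine h1.trans (le_of_eq ?_)
  rw [integral_const_mul, integral_exp_mul_Ioi (by linarith)]
  simp
  ring

/-- The range `σ ≤ x/2 + 2` leaves room for the orders `ν + 1` and `ν + 2` of the recurrence when `σ
≤ 0`. For `x ≥ 8` one has `x/2 + 2 ≤ 3x/4`; for `x ≤ 8` the summand `1` suffices. -/
theorem rpow_neg_quarter_le {σ t x : ℝ} (hσ : 0 ≤ σ) (hx : 1 ≤ x) (hσx : σ ≤ x / 2 + 2) :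
    (1 + |x ^ 2 - σ ^ 2 + t ^ 2| + σ * |t|) ^ (-(1 / 4) : ℝ) ≤ 3 * x ^ (-(1 / 2) : ℝ) := by
  have h1 : x ^ 2 / 64 ≤ 1 + |x ^ 2 - σ ^ 2 + t ^ 2| + σ * |t| := by
    have h2 : 0 ≤ σ * |t| := by positivity
    rcases le_total x 8 with h | h
    · have := abs_nonneg (x ^ 2 - σ ^ 2 + t ^ 2)
      nlinarith
    · have := le_abs_self (x ^ 2 - σ ^ 2 + t ^ 2)
      have h3 : σ ^ 2 ≤ (x / 2 + 2) ^ 2 := pow_le_pow_left₀ hσ hσx 2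
      nlinarith [sq_nonneg t]
  have hx0 : 0 < x := by linarith
  refine (Real.rpow_le_rpow_of_nonpos (by positivity) h1 (by norm_num)).trans ?_
  rw [show x ^ 2 / 64 = x ^ 2 * (1 / 64) by ring, Real.mul_rpow (by positivity) (by norm_num),
    ← Real.rpow_natCast x 2, ← Real.rpow_mul hx0.le, mul_comm,
    show ((2 : ℕ) : ℝ) * -(1 / 4) = -(1 / 2) by norm_num]
  refine mul_le_mul_of_nonneg_right ?_ (by positivity)
  refine le_of_pow_le_pow_left₀ (n := 4) (by norm_num) (by norm_num) ?_
  rw [← Real.rpow_natCast, ← Real.rpow_mul (by norm_num)]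
  norm_num

theorem norm_besselJ_le_of_pos_re {σ t x : ℝ} (hσ : 0 < σ) (hx : 1 ≤ x) (hσx : σ ≤ x / 2 + 2)
    (hs : Complex.sin (Real.pi * (σ + t * Complex.I)) ≠ 0) :
    ‖besselJ (σ + t * Complex.I) x‖ ≤ (3000 + 4 * Real.exp 6) *
      (x ^ (-(1 / 2) : ℝ) * Real.exp (Real.pi / 2 * |t|)) := by
  have hm : 1 ≤ max σ (max |t| x) := hx.trans ((le_max_right _ _).trans (le_max_right _ _))
  have h1 := norm_besselJ_le_of_one_le_max hσ (by linarith) hm hs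
  have h2 := mul_le_mul_of_nonneg_right (rpow_neg_quarter_le (t := t) hσ.le hx hσx)
    (Real.exp_pos (Real.pi / 2 * |t|)).le
  have h3 : 0 ≤ 4 * Real.exp 6 * (x ^ (-(1 / 2) : ℝ) * Real.exp (Real.pi / 2 * |t|)) := by
    positivity
  linarith

theorem norm_besselYQuot_le_of_pos_re {σ t x : ℝ} (hσ : 0 < σ) (hx : 1 ≤ x)
    (hσx : σ ≤ x / 2 + 2) (hs : Complex.sin (Real.pi * (σ + t * Complex.I)) ≠ 0) :
    ‖besselYQuot (σ + t * Complex.I) x‖ ≤ (3000 + 4 * Real.exp 6) *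
      (x ^ (-(1 / 2) : ℝ) * Real.exp (Real.pi / 2 * |t|)) := by
  have hx0 : 0 < x := by linarith
  have hm : 1 ≤ max σ (max |t| x) := hx.trans ((le_max_right _ _).trans (le_max_right _ _))
  have h1 := norm_besselP_pair_le hσ hx0 hm
  have h2 := mul_le_mul_of_nonneg_right (rpow_neg_quarter_le (t := t) hσ.le hx hσx)
    (Real.exp_pos (Real.pi / 2 * |t|)).le
  have h3 := norm_schlafliRay_neg_le (ν := σ + t * Complex.I) hx (by simpa using hσx)
  have h4 : 4 * Real.exp 6 / x ≤
      4 * Real.exp 6 * (x ^ (-(1 / 2) : ℝ) * Real.exp (Real.pi / 2 * |t|)) := by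
    rw [div_eq_mul_inv, ← Real.rpow_neg_one]
    refine mul_le_mul_of_nonneg_left ?_ (by positivity)
    have e1 : x ^ (-1 : ℝ) ≤ x ^ (-(1 / 2) : ℝ) :=
      Real.rpow_le_rpow_of_exponent_le hx (by norm_num)
    have e2 : 1 ≤ Real.exp (Real.pi / 2 * |t|) := Real.one_le_exp (by positivity)
    have e3 : 0 < x ^ (-(1 / 2) : ℝ) := by positivity
    nlinarith
  have hpi := Real.pi_gt_three
  have n1 : ‖(2 * Real.pi * Complex.I : ℂ)‖ = 2 * Real.pi := by
    simp [abs_of_pos Real.pi_pos]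
  have n2 : ‖(Real.pi : ℂ)‖ = Real.pi := by simp [abs_of_pos Real.pi_pos]
  rw [besselYQuot_eq_besselP (by simpa using hσ) hx0 hs]
  refine (norm_sub_le _ _).trans ?_
  rw [norm_div, norm_div, n1, n2]
  have k1 := norm_sub_le (besselP (σ + t * Complex.I) x)
    ((starRingEnd ℂ) (besselP ((starRingEnd ℂ) (σ + t * Complex.I)) x))
  set B := x ^ (-(1 / 2) : ℝ) * Real.exp (Real.pi / 2 * |t|) with hB
  have hB0 : 0 ≤ B := by positivity
  have k2 : ‖besselP (σ + t * Complex.I) x -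
      (starRingEnd ℂ) (besselP ((starRingEnd ℂ) (σ + t * Complex.I)) x)‖ / (2 * Real.pi) ≤
      3000 * B := by
    rw [div_le_iff₀ (by positivity)]
    nlinarith
  have k3 : ‖schlafliRay (-(σ + t * Complex.I)) x‖ / Real.pi ≤ 4 * Real.exp 6 * B := by
    rw [div_le_iff₀ (by positivity)]
    have : 0 ≤ 4 * Real.exp 6 * B := by positivity
    nlinarith
  linarith

/-! ### Three-term recurrences, integer orders as limits, and extension to `Re ν ≥ -1`. -/

theorem besselJ_recurrence (ν : ℂ) {x : ℝ} (hx : 0 < x) :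
    besselJ (ν - 1) x + besselJ (ν + 1) x = 2 * ν / x * besselJ ν x := by
  have hx' : (x : ℂ) ≠ 0 := by exact_mod_cast hx.ne'
  have hz : ((x / 2 : ℝ) : ℂ) ≠ 0 := by exact_mod_cast (by positivity : x / 2 ≠ 0)
  set c : ℂ := ((x ^ 2 / 4 : ℝ) : ℂ) with hc
  set f : ℂ → ℕ → ℂ := fun ν k => (-1) ^ k * c ^ k / (k.factorial : ℂ) *
    (Complex.Gamma (ν + k + 1))⁻¹ with hf
  have hsum : ∀ ν, Summable (f ν) := fun ν => summable_besselJ ν x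
  have key : ∑' k, f (ν - 1) k = ν * (∑' k, f ν k) - c * ∑' k, f (ν + 1) k := by
    -- This is `1/Γ(ν + k) = (ν + k)/Γ(ν + k + 1)`; the part with the factor `k` becomes the series
    -- at `ν + 1` after an index shift.
    have h1 : ∀ k, f (ν - 1) k = ν * f ν k + k * f ν k := fun k => by
      simp only [hf]
      have := Complex.one_div_Gamma_eq_self_mul_one_div_Gamma_add_one (ν + k)
      rw [show ν - 1 + k + 1 = ν + k by ring, this]
      ring
    have h2 : Summable fun k : ℕ => (k : ℂ) * f ν k := by
      have := (hsum (ν - 1)).sub ((hsum ν).mul_left ν)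
      refine this.congr fun k => ?_
      rw [h1]
      ring
    have h3 : ∑' k : ℕ, (k : ℂ) * f ν k = -c * ∑' k, f (ν + 1) k := by
      rw [h2.tsum_eq_zero_add, Nat.cast_zero, zero_mul, zero_add, ← tsum_mul_left]
      refine tsum_congr fun k => ?_
      simp only [hf]
      rw [Nat.factorial_succ, show ν + ((k + 1 : ℕ) : ℂ) + 1 = ν + 1 + k + 1 by push_cast; ring]
      have h4 : ((k + 1 : ℕ) : ℂ) ≠ 0 := by exact_mod_cast k.succ_ne_zero
      have h5 : (k.factorial : ℂ) ≠ 0 := by exact_mod_cast k.factorial_ne_zero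
      rw [Nat.cast_mul]
      field_simp
      ring
    rw [tsum_congr h1, ((hsum ν).mul_left ν).tsum_add h2, h3, tsum_mul_left]
    ring
  unfold besselJ
  change _ * ∑' k, f (ν - 1) k + _ * ∑' k, f (ν + 1) k = _ * (_ * ∑' k, f ν k)
  rw [key, Complex.cpow_sub _ _ hz, Complex.cpow_add _ _ hz, Complex.cpow_one, hc]
  push_cast
  field_simp
  ring

theorem besselYQuot_recurrence (ν : ℂ) {x : ℝ} (hx : 0 < x) :
    besselYQuot (ν - 1) x + besselYQuot (ν + 1) x = 2 * ν / x * besselYQuot ν x := by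
  have h1 := besselJ_recurrence ν hx
  have h2 := besselJ_recurrence (-ν) hx
  unfold besselYQuot
  rw [show -(ν - 1) = -ν + 1 by ring, show -(ν + 1) = -ν - 1 by ring, mul_sub, mul_add, mul_one,
    Complex.sin_sub_pi, Complex.cos_sub_pi, Complex.sin_add_pi, Complex.cos_add_pi, ← add_div,
    div_neg, ← neg_div, ← mul_div_assoc]
  congr 1
  linear_combination Complex.cos (Real.pi * ν) * h1 + h2

theorem sin_pi_mul_ne_zero_of_floor_lt {ν : ℂ} (h1 : (⌊ν.re⌋ : ℝ) < ν.re) :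
    Complex.sin (Real.pi * ν) ≠ 0 := by
  intro h
  obtain ⟨k, hk⟩ := Complex.sin_eq_zero_iff.1 h
  have hpi : (Real.pi : ℂ) ≠ 0 := by exact_mod_cast Real.pi_ne_zero
  have h2 : ν = k := mul_left_cancel₀ hpi (by rw [hk, mul_comm])
  rw [h2] at h1
  simp at h1

theorem eventually_sin_pi_mul_add_ne_zero (ν : ℂ) :
    ∀ᶠ ε : ℝ in 𝓝[>] 0, Complex.sin (Real.pi * (ν + ε)) ≠ 0 := by
  have h : (0 : ℝ) < ⌊ν.re⌋ + 1 - ν.re := by linarith [Int.lt_floor_add_one ν.re]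
  filter_upwards [Ioo_mem_nhdsGT h] with ε hε
  have e : (ν + ε).re = ν.re + ε := by simp
  have h2 : ⌊(ν + ε).re⌋ = ⌊ν.re⌋ := by
    rw [e, Int.floor_eq_iff]
    exact ⟨by linarith [Int.floor_le ν.re, hε.1], by linarith [hε.2]⟩
  refine sin_pi_mul_ne_zero_of_floor_lt ?_
  rw [h2, e]
  linarith [Int.floor_le ν.re, hε.1]

theorem tendsto_add_ofReal_nhdsNE (ν : ℂ) :
    Tendsto (fun ε : ℝ => ν + ε) (𝓝[>] 0) (𝓝[≠] ν) := by
  refine tendsto_nhdsWithin_iff.2 ⟨?_, ?_⟩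
  · have : Continuous fun ε : ℝ => ν + ε := by fun_prop
    have := this.tendsto 0
    rw [Complex.ofReal_zero, add_zero] at this
    exact this.mono_left nhdsWithin_le_nhds
  · filter_upwards [self_mem_nhdsWithin] with ε hε
    have : (ε : ℂ) ≠ 0 := by exact_mod_cast (ne_of_gt hε)
    simpa using this

theorem tendsto_besselYQuot_nhdsNE (ν : ℂ) {x : ℝ} (hx : 0 < x) :
    Tendsto (fun μ => besselYQuot μ x) (𝓝[≠] ν) (𝓝 (besselY ν x)) := by
  by_cases hn : ∃ n : ℤ, ν = n
  · obtain ⟨n, rfl⟩ := hn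
    exact tendsto_besselYQuot n hx
  · have hs : Complex.sin (Real.pi * ν) ≠ 0 := by
      intro h
      obtain ⟨k, hk⟩ := Complex.sin_eq_zero_iff.1 h
      have hpi : (Real.pi : ℂ) ≠ 0 := by exact_mod_cast Real.pi_ne_zero
      exact hn ⟨k, mul_left_cancel₀ hpi (by rw [hk, mul_comm])⟩
    rw [besselY, if_neg hn]
    have hJ := (differentiable_besselJ hx).continuous
    have h1 : ContinuousAt (fun μ => besselYQuot μ x) ν := by
      unfold besselYQuot
      have h2 : Continuous fun ν : ℂ => besselJ (-ν) x := hJ.comp continuous_neg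
      refine ContinuousAt.div ?_ ?_ hs
      · exact ((hJ.mul (by fun_prop)).sub h2).continuousAt
      · fun_prop
    exact h1.tendsto.mono_left nhdsWithin_le_nhds

/-- Extends a bound for a solution of the recurrence of the Bessel functions to the left, and to
integer orders. -/
theorem norm_le_of_recurrence {f : ℂ → ℂ} {g : ℂ → ℂ} {x K : ℝ} (hx : 1 ≤ x)
    (hrec : ∀ ν, f (ν - 1) + f (ν + 1) = 2 * ν / x * f ν)
    (hlim : ∀ ν, Tendsto f (𝓝[≠] ν) (𝓝 (g ν)))
    (hf : ∀ σ t : ℝ, 0 < σ → σ ≤ x / 2 + 2 →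
      Complex.sin (Real.pi * (σ + t * Complex.I)) ≠ 0 →
      ‖f (σ + t * Complex.I)‖ ≤ K * (x ^ (-(1 / 2) : ℝ) * Real.exp (Real.pi / 2 * |t|)))
    {σ t : ℝ} (hσ : -1 ≤ σ) (hσx : σ < x / 2) (ht : |t| ≤ x) :
    ‖g (σ + t * Complex.I)‖ ≤
      5 * K * (x ^ (-(1 / 2) : ℝ) * Real.exp (Real.pi / 2 * |t|)) := by
  have hx0 : 0 < x := by linarith
  set B := x ^ (-(1 / 2) : ℝ) * Real.exp (Real.pi / 2 * |t|) with hB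
  have hB0 : 0 < B := by positivity
  -- The inequality `-1 < σ` is strict so that `σ + 1 > 0`. The limit from the right in `σ` then
  -- adds `σ = -1` and the integer orders.
  have key : ∀ σ : ℝ, -1 < σ → σ < x / 2 → Complex.sin (Real.pi * (σ + t * Complex.I)) ≠ 0 →
      ‖f (σ + t * Complex.I)‖ ≤ 5 * K * B := by
    intro σ hσ hσx hs
    rcases lt_or_ge 0 σ with h0 | h0
    · have := hf σ t h0 (by linarith) hs
      have := (norm_nonneg _).trans this
      linarith
    · have e1 : (σ : ℂ) + t * Complex.I + 1 = ((σ + 1 : ℝ) : ℂ) + t * Complex.I := by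
        push_cast
        ring
      have e2 : (σ : ℂ) + t * Complex.I + 1 + 1 = ((σ + 2 : ℝ) : ℂ) + t * Complex.I := by
        push_cast
        ring
      have s1 : Complex.sin (Real.pi * (((σ + 1 : ℝ) : ℂ) + t * Complex.I)) ≠ 0 := by
        rw [← e1, mul_add, mul_one, Complex.sin_add_pi]
        exact neg_ne_zero.2 hs
      have s2 : Complex.sin (Real.pi * (((σ + 2 : ℝ) : ℂ) + t * Complex.I)) ≠ 0 := by
        rw [← e2, e1, mul_add, mul_one, Complex.sin_add_pi]
        exact neg_ne_zero.2 s1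
      have b1 := hf (σ + 1) t (by linarith) (by linarith) s1
      have b2 := hf (σ + 2) t (by linarith) (by linarith) s2
      have hr := hrec (σ + t * Complex.I + 1)
      rw [add_sub_cancel_right, e2, e1] at hr
      rw [eq_sub_of_add_eq hr]
      refine (norm_sub_le _ _).trans ?_
      -- Here `|ν + 1| ≤ 1 + |t| ≤ 2x`. Hence the constant `5 = 4 + 1` from the terms at `ν + 1` and
      -- `ν + 2`.
      have n1 : ‖2 * (((σ + 1 : ℝ) : ℂ) + t * Complex.I) / x‖ ≤ 4 := by
        rw [norm_div, norm_mul, Complex.norm_real, Real.norm_of_nonneg hx0.le,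
          div_le_iff₀ hx0, Complex.norm_ofNat]
        have h3 := norm_add_le ((σ + 1 : ℝ) : ℂ) (t * Complex.I)
        rw [norm_mul, Complex.norm_I, mul_one, Complex.norm_real, Complex.norm_real,
          Real.norm_of_nonneg (by linarith), Real.norm_eq_abs] at h3
        linarith
      rw [norm_mul]
      have n2 := mul_le_mul n1 b1 (norm_nonneg _) (by norm_num)
      linarith
  have lim := ((hlim (σ + t * Complex.I)).comp (tendsto_add_ofReal_nhdsNE _)).norm
  refine le_of_tendsto lim ?_
  have hd : (0 : ℝ) < x / 2 - σ := by linarith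
  filter_upwards [eventually_sin_pi_mul_add_ne_zero (σ + t * Complex.I), Ioo_mem_nhdsGT hd]
    with ε h1 h2
  have e : (σ : ℂ) + t * Complex.I + ε = ((σ + ε : ℝ) : ℂ) + t * Complex.I := by
    push_cast
    ring
  rw [e] at h1
  simp only [Function.comp_apply]
  rw [e]
  exact key _ (by linarith [h2.1]) (by linarith [h2.2]) h1

/-! ### Small arguments by the power series, and the final bounds. -/

theorem exists_norm_besselJ_le_rpow_re : ∃ M : ℝ, 0 ≤ M ∧ ∀ (ν : ℂ) (x : ℝ), ‖ν‖ ≤ 2 → 0 < x →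
    x ≤ 1 → ‖besselJ ν x‖ ≤ M * (x / 2) ^ ν.re := by
  obtain ⟨M, hM⟩ := exists_norm_inv_Gamma_le 2
  have hM0 : 0 ≤ M := (norm_nonneg _).trans (hM 0 0 (by simp))
  refine ⟨3 * M, by positivity, fun ν x hν hx hx1 => ?_⟩
  have hsum := (Real.summable_pow_div_factorial (x ^ 2 / 4)).mul_right M
  have h1 := tsum_of_norm_bounded hsum.hasSum
    fun k => norm_besselJ_term_le k x (hM k ν (by simpa using hν))
  rw [tsum_mul_right] at h1
  have h2 : ∑' k : ℕ, (x ^ 2 / 4) ^ k / (k.factorial : ℝ) = Real.exp (x ^ 2 / 4) := by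
    rw [Real.exp_eq_exp_ℝ, NormedSpace.exp_eq_tsum_div]
  have h3 : Real.exp (x ^ 2 / 4) ≤ 3 := by
    refine (Real.exp_le_exp.2 (by nlinarith : x ^ 2 / 4 ≤ 1)).trans ?_
    linarith [Real.exp_one_lt_d9]
  rw [h2] at h1
  rw [besselJ, norm_mul, Complex.norm_cpow_eq_rpow_re_of_pos (by positivity), mul_comm]
  refine mul_le_mul_of_nonneg_right (h1.trans ?_) (by positivity)
  exact mul_le_mul_of_nonneg_right h3 hM0

theorem norm_add_mul_I_le (σ t : ℝ) : ‖(σ : ℂ) + t * Complex.I‖ ≤ |σ| + |t| := by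
  refine (norm_add_le _ _).trans ?_
  simp

theorem exists_norm_besselJ_le : ∃ C : ℝ, ∀ σ t x : ℝ, 0 ≤ σ → 0 < x →
    ‖besselJ (σ + t * Complex.I) x‖ ≤
      C * ((1 + |x ^ 2 - σ ^ 2 + t ^ 2| + σ * |t|) ^ (-(1 / 4) : ℝ) *
        Real.exp (Real.pi / 2 * |t|)) := by
  obtain ⟨M, hM0, hM⟩ := exists_norm_besselJ_le_rpow_re
  have key : ∀ σ t x : ℝ, 0 < σ → 0 < x →
      Complex.sin (Real.pi * (σ + t * Complex.I)) ≠ 0 →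
      ‖besselJ (σ + t * Complex.I) x‖ ≤
        (1000 + 5 * M) * ((1 + |x ^ 2 - σ ^ 2 + t ^ 2| + σ * |t|) ^ (-(1 / 4) : ℝ) *
          Real.exp (Real.pi / 2 * |t|)) := by
    intro σ t x hσ hx hs
    have hN1 : 1 ≤ 1 + |x ^ 2 - σ ^ 2 + t ^ 2| + σ * |t| := by
      have := abs_nonneg (x ^ 2 - σ ^ 2 + t ^ 2)
      have : 0 ≤ σ * |t| := by positivity
      linarith
    rcases le_total 1 (max σ (max |t| x)) with h | h
    · have h1 := norm_besselJ_le_of_one_le_max hσ hx h hs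
      set B := (1 + |x ^ 2 - σ ^ 2 + t ^ 2| + σ * |t|) ^ (-(1 / 4) : ℝ) *
          Real.exp (Real.pi / 2 * |t|)
      have : 0 ≤ 5 * M * B := by positivity
      linarith
    -- When all parameters are at most `1`, the series bounds `J_ν` by a constant, while `N ≤ 5`
    -- keeps the right-hand side away from `0`.
    · obtain ⟨h1, h2⟩ := max_le_iff.1 h
      obtain ⟨h2, h3⟩ := max_le_iff.1 h2
      have hN5 := one_add_abs_le_five_mul_sq hσ.le hx.le le_rfl h1 h2 h3
      have b := hM (σ + t * Complex.I) x ((norm_add_mul_I_le σ t).trans (by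
        rw [abs_of_pos hσ]; linarith)) hx h3
      have b1 : (x / 2) ^ ((σ : ℂ) + t * Complex.I).re ≤ 1 :=
        Real.rpow_le_one (by positivity) (by linarith) (by simpa using hσ.le)
      set N := 1 + |x ^ 2 - σ ^ 2 + t ^ 2| + σ * |t| with hN
      have b2 : 1 / 5 ≤ N ^ (-(1 / 4) : ℝ) := by
        have c1 : N ^ (-1 : ℝ) ≤ N ^ (-(1 / 4) : ℝ) :=
          Real.rpow_le_rpow_of_exponent_le hN1 (by norm_num)
        rw [Real.rpow_neg_one] at c1
        refine le_trans ?_ c1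
        rw [← one_div]
        exact one_div_le_one_div_of_le (by linarith) (by linarith)
      have b3 : 1 ≤ Real.exp (Real.pi / 2 * |t|) := Real.one_le_exp (by positivity)
      have b4 : 1 / 5 ≤ N ^ (-(1 / 4) : ℝ) * Real.exp (Real.pi / 2 * |t|) := by nlinarith
      calc _ ≤ M * 1 := b.trans (mul_le_mul_of_nonneg_left b1 hM0)
        _ ≤ (1000 + 5 * M) * (1 / 5) := by linarith
        _ ≤ _ := mul_le_mul_of_nonneg_left b4 (by positivity)
  refine ⟨1000 + 5 * M, fun σ t x hσ hx => ?_⟩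
  have hJ := (differentiable_besselJ hx).continuous
  have lim1 := ((hJ.tendsto (σ + t * Complex.I)).comp
    ((tendsto_add_ofReal_nhdsNE (σ + t * Complex.I)).mono_right nhdsWithin_le_nhds)).norm
  have lim2 : Tendsto (fun ε : ℝ => (1000 + 5 * M) *
      ((1 + |x ^ 2 - (σ + ε) ^ 2 + t ^ 2| + (σ + ε) * |t|) ^ (-(1 / 4) : ℝ) *
          Real.exp (Real.pi / 2 * |t|))) (𝓝[>] 0) (𝓝 ((1000 + 5 * M) *
      ((1 + |x ^ 2 - (σ + 0) ^ 2 + t ^ 2| + (σ + 0) * |t|) ^ (-(1 / 4) : ℝ) *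
          Real.exp (Real.pi / 2 * |t|)))) := by
    refine Tendsto.mono_left ?_ nhdsWithin_le_nhds
    refine ((ContinuousAt.rpow_const (by fun_prop) (Or.inl ?_)).tendsto.mul_const _).const_mul _
    rw [add_zero]
    positivity
  rw [add_zero] at lim2
  refine le_of_tendsto_of_tendsto lim1 lim2 ?_
  filter_upwards [eventually_sin_pi_mul_add_ne_zero (σ + t * Complex.I), self_mem_nhdsWithin]
    with ε h1 h2
  have e : (σ : ℂ) + t * Complex.I + ε = ((σ + ε : ℝ) : ℂ) + t * Complex.I := by
    push_cast
    ring
  rw [e] at h1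
  simp only [Function.comp_apply]
  rw [e]
  exact key _ t x (add_pos_of_nonneg_of_pos hσ h2) hx h1

theorem norm_besselJ_le_rpow_neg_half {σ t x : ℝ} (hσ : -1 ≤ σ) (hσx : σ < x / 2)
    (ht : |t| ≤ x) (hx : 1 ≤ x) :
    ‖besselJ (σ + t * Complex.I) x‖ ≤ 5 * (3000 + 4 * Real.exp 6) *
      (x ^ (-(1 / 2) : ℝ) * Real.exp (Real.pi / 2 * |t|)) := by
  have hx0 : 0 < x := by linarith
  exact norm_le_of_recurrence (f := fun ν => besselJ ν x) (g := fun ν => besselJ ν x) hx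
    (fun ν => besselJ_recurrence ν hx0)
    (fun ν => ((differentiable_besselJ hx0).continuous.tendsto ν).mono_left nhdsWithin_le_nhds)
    (fun σ t h1 h2 h3 => norm_besselJ_le_of_pos_re h1 hx h2 h3) hσ hσx ht

theorem norm_besselY_le_rpow_neg_half {σ t x : ℝ} (hσ : -1 ≤ σ) (hσx : σ < x / 2)
    (ht : |t| ≤ x) (hx : 1 ≤ x) :
    ‖besselY (σ + t * Complex.I) x‖ ≤ 5 * (3000 + 4 * Real.exp 6) *
      (x ^ (-(1 / 2) : ℝ) * Real.exp (Real.pi / 2 * |t|)) := by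
  have hx0 : 0 < x := by linarith
  exact norm_le_of_recurrence (f := fun ν => besselYQuot ν x) (g := fun ν => besselY ν x) hx
    (fun ν => besselYQuot_recurrence ν hx0) (fun ν => tendsto_besselYQuot_nhdsNE ν hx0)
    (fun σ t h1 h2 h3 => norm_besselYQuot_le_of_pos_re h1 hx h2 h3) hσ hσx ht

theorem exists_norm_besselJ_le_rpow_neg_half : ∃ C : ℝ, ∀ σ t x : ℝ, -1 ≤ σ → σ < x / 2 →
    |t| < x → (1 ≤ x ∨ -(1 / 2) ≤ σ) →
    ‖besselJ (σ + t * Complex.I) x‖ ≤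
      C * (x ^ (-(1 / 2) : ℝ) * Real.exp (Real.pi / 2 * |t|)) := by
  obtain ⟨M, hM0, hM⟩ := exists_norm_besselJ_le_rpow_re
  refine ⟨5 * (3000 + 4 * Real.exp 6) + 2 * M, fun σ t x hσ hσx ht h => ?_⟩
  have hx0 : 0 < x := (abs_nonneg t).trans_lt ht
  have hB0 : 0 ≤ x ^ (-(1 / 2) : ℝ) * Real.exp (Real.pi / 2 * |t|) := by positivity
  rcases le_or_gt 1 x with hx | hx
  · refine (norm_besselJ_le_rpow_neg_half hσ hσx ht.le hx).trans ?_
    exact mul_le_mul_of_nonneg_right (by linarith) hB0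
  -- For `x < 1` the series gives size `(x/2)^σ`, which is at most a multiple of `x^(-1/2)` because
  -- `σ ≥ -1/2`.
  · have hσ2 : -(1 / 2) ≤ σ := h.resolve_left (not_le.2 hx)
    have b := hM (σ + t * Complex.I) x ((norm_add_mul_I_le σ t).trans (by
      have : |σ| ≤ 1 := abs_le.2 ⟨by linarith, by linarith⟩
      linarith)) hx0 hx.le
    have b1 : (x / 2) ^ ((σ : ℂ) + t * Complex.I).re ≤ 2 * x ^ (-(1 / 2) : ℝ) := by
      have e : ((σ : ℂ) + t * Complex.I).re = σ := by simp
      rw [e]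
      refine (Real.rpow_le_rpow_of_exponent_ge (by positivity) (by linarith) hσ2).trans ?_
      rw [Real.div_rpow hx0.le (by norm_num), div_eq_inv_mul, ← Real.rpow_neg (by norm_num)]
      refine mul_le_mul_of_nonneg_right ?_ (by positivity)
      rw [neg_neg]
      calc (2 : ℝ) ^ (1 / 2 : ℝ) ≤ 2 ^ (1 : ℝ) :=
            Real.rpow_le_rpow_of_exponent_le (by norm_num) (by norm_num)
        _ = 2 := Real.rpow_one 2
    have b3 : 1 ≤ Real.exp (Real.pi / 2 * |t|) := Real.one_le_exp (by positivity)
    have b4 : 0 < x ^ (-(1 / 2) : ℝ) := by positivity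
    calc _ ≤ M * (2 * x ^ (-(1 / 2) : ℝ)) := b.trans (mul_le_mul_of_nonneg_left b1 hM0)
      _ = 2 * M * (x ^ (-(1 / 2) : ℝ) * 1) := by ring
      _ ≤ 2 * M * (x ^ (-(1 / 2) : ℝ) * Real.exp (Real.pi / 2 * |t|)) := by gcongr
      _ ≤ _ := mul_le_mul_of_nonneg_right (by linarith [Real.exp_pos 6]) hB0

end

theorem mainTheorem9 :
    (∃ C : ℝ, ∀ σ t x : ℝ, 0 ≤ σ → 0 < x →
      ‖besselJ (σ + t * Complex.I) x‖ ≤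
        C * ((1 + |x ^ 2 - σ ^ 2 + t ^ 2| + σ * |t|) ^ (-(1 / 4) : ℝ) *
          Real.exp (Real.pi / 2 * |t|))) ∧
    (∃ C : ℝ, ∀ σ t x : ℝ, -1 ≤ σ → σ < x / 2 → |t| < x → (1 ≤ x ∨ -(1 / 2) ≤ σ) →
      ‖besselJ (σ + t * Complex.I) x‖ ≤
        C * (x ^ (-(1 / 2) : ℝ) * Real.exp (Real.pi / 2 * |t|))) ∧
    (∃ C : ℝ, ∀ σ t x : ℝ, -1 ≤ σ → σ < x / 2 → max |t| 1 ≤ x →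
      ‖besselY (σ + t * Complex.I) x‖ ≤
        C * (x ^ (-(1 / 2) : ℝ) * Real.exp (Real.pi / 2 * |t|))) := by
  refine ⟨exists_norm_besselJ_le, exists_norm_besselJ_le_rpow_neg_half,
    5 * (3000 + 4 * Real.exp 6), fun σ t x hσ hσx h => ?_⟩
  obtain ⟨ht, hx⟩ := max_le_iff.1 h
  exact norm_besselY_le_rpow_neg_half hσ hσx ht hx
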